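/- Let $\sigma=\sigma_{\mathcal B}\sqcup\sigma_{\mathcal D}$ be a finite relational signature, where the relations of $\sigma_{\mathcal B}$ are called base relations and each relation of $\sigma_{\mathcal D}$ (called distinguished) is a binary relation $R^+$ associated with a binary base relation $R\in\sigma_{\mathcal B}$ (distinct distinguished relations being associated with distinct base relations). A fact is an expression $R(a_1,\dots,a_n)$ with $R\in\sigma$ of arity $n$ and elements $a_1,\dots,a_n$. An inclusion dependency on $\sigma$ is a sentence $\forall\vec x\,(R(\vec x)\to\exists\vec y\,S(\vec x,\vec y))$ with one body atom and one head atom (not all of the variables $\vec x$ need occur in the head), in which no variable occurs twice in the same atom; both atoms may use base or distinguished relations. A Boolean conjunctive query (CQ) on $\sigma_{\mathcal B}$ is a sentence $\exists\vec x\,\varphi$ where $\varphi$ is a conjunction of equalities and of atoms over relations of $\sigma_{\mathcal B}$. For a finite set of facts $\mathcal F_0$, a finite set $\Sigma$ of inclusion dependencies and a CQ $Q$, we say that $\mathcal F_0,\Sigma$ entails $Q$ over transitive closure, written $\mathrm{QAtc}(\mathcal F_0,\Sigma,Q)$, if every finite or infinite set of facts $\mathcal F\supseteq\mathcal F_0$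 which satisfies $\Sigma$, and in which each $R^+\in\sigma_{\mathcal D}$ is exactly the (not necessarily reflexive) transitive closure of the corresponding $R$, satisfies $Q$. Theorem. There are a signature $\sigma=\sigma_{\mathcal B}\sqcup\sigma_{\mathcal D}$ with a single distinguished relation $S^+$ in $\sigma_{\mathcal D}$, a finite set $\Sigma$ of inclusion dependencies on $\sigma$, and a Boolean CQ $Q$ on $\sigma_{\mathcal B}$, such that the following problem is undecidable: given a finite set of facts $\mathcal F_0$ on $\sigma$, decide whether $\mathrm{QAtc}(\mathcal F_0,\Sigma,Q)$ holds. -/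

import Mathlib

/-- A finite relational signature split into base relations (indexed by `Fin numBase`) and
distinguished relations (indexed by `Fin numDist`).  Each distinguished relation is of the form
`R⁺` for a binary base relation `R`, here `under d`, and is itself binary. -/
structure TCSignature where
  numBase : ℕ
  numDist : ℕ
  baseArity : Fin numBase → ℕ
  under : Fin numDist → Fin numBase
  under_injective : Function.Injective under
  under_binary : ∀ d, baseArity (under d) = 2

namespace TCSignature

/-- All relation symbols: base ones (`Sum.inl`) and distinguished ones (`Sum.inr`). -/
abbrev Rel (σ : TCSignature) : Type := Fin σ.numBase ⊕ Fin σ.numDist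

/-- The arity of a relation symbol; distinguished relations are binary. -/
def arity (σ : TCSignature) : σ.Rel → ℕ
  | Sum.inl b => σ.baseArity b
  | Sum.inr _ => 2

theorem arity_inr (σ : TCSignature) (d : Fin σ.numDist) : σ.arity (Sum.inr d) = 2 := rfl

theorem arity_under (σ : TCSignature) (d : Fin σ.numDist) :
    σ.arity (Sum.inl (σ.under d)) = 2 := σ.under_binary d

end TCSignature

/-- A fact `R(a₁, …, aₙ)` over the elements of `A`.  With `A` a type of variables, this is a
relational atom. -/
structure RelFact (σ : TCSignature) (A : Type*) where
  rel : σ.Rel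
  args : Fin (σ.arity rel) → A

namespace RelFact

/-- Apply a function to all the elements of a fact (or instantiate the variables of an atom). -/
def map {σ : TCSignature} {A B : Type*} (h : A → B) (f : RelFact σ A) : RelFact σ B :=
  ⟨f.rel, fun i => h (f.args i)⟩

/-- The fact `r(a, b)` for a binary relation symbol `r`. -/
def pair {σ : TCSignature} {A : Type*} (r : σ.Rel) (hr : σ.arity r = 2) (a b : A) :
    RelFact σ A :=
  ⟨r, fun i => ![a, b] (Fin.cast hr i)⟩

/-- A fact is the same thing as a relation symbol with a list of elements of the right length. -/
def equivList (σ : TCSignature) (A : Type*) :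
    RelFact σ A ≃ {p : σ.Rel × List A // p.2.length = σ.arity p.1} where
  toFun f := ⟨(f.rel, List.ofFn f.args), List.length_ofFn⟩
  invFun p := ⟨p.1.1, fun i => p.1.2.get (Fin.cast p.2.symm i)⟩
  left_inv := by
    rintro ⟨r, v⟩
    simp only [RelFact.mk.injEq, heq_eq_eq, true_and]
    funext i
    simp
  right_inv := by
    rintro ⟨⟨r, l⟩, h⟩
    apply Subtype.ext
    refine Prod.ext rfl ?_
    apply List.ext_get
    · simpa using h.symm
    · intro n h1 h2
      simp

theorem primrecPred_length_eq_arity (σ : TCSignature) (A : Type*) [Primcodable A] :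
    PrimrecPred (fun p : σ.Rel × List A => p.2.length = σ.arity p.1) :=
  Primrec.eq.comp (Primrec.list_length.comp Primrec.snd)
    ((Primrec.dom_finite σ.arity).comp Primrec.fst)

/-- The encoding of facts used for computability: a relation symbol with its list of arguments. -/
instance {σ : TCSignature} {A : Type*} [Primcodable A] : Primcodable (RelFact σ A) :=
  letI : Primcodable {p : σ.Rel × List A // p.2.length = σ.arity p.1} :=
    Primcodable.subtype (primrecPred_length_eq_arity σ A)
  Primcodable.ofEquiv {p : σ.Rel × List A // p.2.length = σ.arity p.1} (equivList σ A)

end RelFact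

/-- The domain of a set of facts: the elements that appear as arguments in its facts. -/
def factElems {σ : TCSignature} {A : Type*} (F : Set (RelFact σ A)) : Set A :=
  {a | ∃ f ∈ F, a ∈ Set.range f.args}

/-- Every distinguished relation `R⁺` is interpreted in `F` as the (not necessarily reflexive)
transitive closure of the base relation `R`. -/
def RespectsTC {σ : TCSignature} {A : Type*} (F : Set (RelFact σ A)) : Prop :=
  ∀ (d : Fin σ.numDist) (a b : A),
    RelFact.pair (Sum.inr d) (σ.arity_inr d) a b ∈ F ↔
      Relation.TransGen
        (fun x y => RelFact.pair (Sum.inl (σ.under d)) (σ.arity_under d) x y ∈ F) a b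

/-- An inclusion dependency `∀ x⃗, R(x⃗) → ∃ y⃗, S(x⃗, y⃗)`: one atom in the body, one atom in the
head, and no variable occurring twice in the same atom.  Variables are natural numbers; those of
the head that do not occur in the body are the existentially quantified ones. -/
structure InclDep (σ : TCSignature) where
  body : RelFact σ ℕ
  head : RelFact σ ℕ
  body_injective : Function.Injective body.args
  head_injective : Function.Injective head.args

/-- Every match of the body extends to a match of the head that agrees on the body variables. -/
def InclDep.Holds {σ : TCSignature} {A : Type*} (τ : InclDep σ) (F : Set (RelFact σ A)) : Prop :=
  ∀ h : ℕ → A, τ.body.map h ∈ F →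
    ∃ h' : ℕ → A, (∀ v ∈ Set.range τ.body.args, h' v = h v) ∧ τ.head.map h' ∈ F

/-- An atomic formula with variables in `V`: a relational atom or an equality. -/
inductive QAtom (σ : TCSignature) (V : Type) where
  | rel (f : RelFact σ V) : QAtom σ V
  | eq (v w : V) : QAtom σ V

/-- Truth of an atomic formula in a set of facts under an assignment. -/
def QAtom.Holds {σ : TCSignature} {V : Type} {A : Type*} (F : Set (RelFact σ A)) (h : V → A) :
    QAtom σ V → Prop
  | QAtom.rel f => f.map h ∈ F
  | QAtom.eq v w => h v = h w

/-- The atom does not use a distinguished relation. -/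
def QAtom.IsBase {σ : TCSignature} {V : Type} : QAtom σ V → Prop
  | QAtom.rel f => f.rel.isLeft = true
  | QAtom.eq _ _ => True

/-- A Boolean conjunctive query `∃ x₁ … xₙ, α₁ ∧ … ∧ αₘ`. -/
structure BoolCQ (σ : TCSignature) where
  numVars : ℕ
  atoms : List (QAtom σ (Fin numVars))

/-- The query only uses base relations (and equality). -/
def BoolCQ.IsBase {σ : TCSignature} (Q : BoolCQ σ) : Prop :=
  ∀ α ∈ Q.atoms, α.IsBase

/-- Satisfaction of a Boolean conjunctive query, quantifiers ranging over the domain of `F`. -/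
def BoolCQ.Holds {σ : TCSignature} {A : Type*} (Q : BoolCQ σ) (F : Set (RelFact σ A)) : Prop :=
  ∃ h : Fin Q.numVars → A, (∀ v, h v ∈ factElems F) ∧ ∀ α ∈ Q.atoms, α.Holds F h

/-- `F₀` and `Θ` entail `Q` over transitive closure: every finite or infinite set of facts `F`
containing `F₀`, satisfying `Θ`, and interpreting each `R⁺` as the transitive closure of `R`,
satisfies `Q`.  The elements of `F₀` are named by natural numbers; the elements of `F` come from
an arbitrary type `A` in which these names are interpreted by distinct elements. -/
def EntailsTC {σ : TCSignature} (F₀ : Set (RelFact σ ℕ)) (Θ : Set (InclDep σ)) (Q : BoolCQ σ) :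
    Prop :=
  ∀ (A : Type) (ι : ℕ → A), Function.Injective ι →
    ∀ F : Set (RelFact σ A),
      RelFact.map ι '' F₀ ⊆ F → (∀ τ ∈ Θ, τ.Holds F) → RespectsTC F → Q.Holds F

/-! ### A fixed Turing machine with undecidable halting problem. -/

section

open Turing

/-! A Turing machine with undecidable halting problem is simulated by a one-dimensional cellular
automaton with states `Fin κ`. Each initial word is turned into a set of facts that entails the
query exactly when the run on that word meets a target state (`Grid.entailsTC_iff`).

An inclusion dependency has one body atom, so by itself it can neither form the product of a time
axis with a space axis nor offer a choice of label for a cell. Transitive closure supplies both.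
Time runs backwards along S down to an origin, from which two S-rays of positions start; hence every
time reaches every position and S⁺ contains the whole grid. Each S⁺ pair must have a `label` atom
whose last two arguments again form an S⁺ pair, and these are joined by a path of finite but
unspecified length. A path of k + 1 steps with k < κ codes the state k; all longer paths share the
extra label κ.

The query looks for a defect: a window with a wrong successor, or a target state. The disjunction of
the finitely many defect patterns becomes one conjunction: a dummy element satisfies every pattern
with a lowered flag, while an Or atom demands a tuple of flags in which one is raised. If the run
meets a target, a model without defect would copy the space-time diagram row by row and so contain
the target, itself a defect (`Grid.query_holds_of_halts`). If it never does, the diagram itself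
yields a model without defect (`Grid.not_query_holds_model`). -/

theorem partrec_universal : Partrec fun n : ℕ => (Denumerable.ofNat Nat.Partrec.Code n).eval 0 :=
  Nat.Partrec.Code.eval_part.comp (Computable.ofNat _) (Computable.const 0)

/-- A fixed program whose halting problem, as a function of its single input, is undecidable. -/
theorem exists_code_undecidable :
    ∃ c : ToPartrec.Code, ¬ ComputablePred fun n : ℕ => (c.eval [n]).Dom := by
  obtain ⟨c, hc⟩ := ToPartrec.Code.exists_code (Nat.Partrec'.part_iff₁.2 partrec_universal)
  refine ⟨c, fun h => ComputablePred.halting_problem 0 ?_⟩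
  -- The input of the universal program is the number of a code `d`, so deciding its halting would
  -- decide whether `d` halts on 0.
  refine ComputablePred.computable_of_manyOneReducible
    ⟨Encodable.encode, Computable.encode, fun d => ?_⟩ h
  have := hc (Encodable.encode d ::ᵥ List.Vector.nil)
  simp only [List.Vector.head_cons, Denumerable.ofNat_encode] at this
  change _ ↔ (c.eval (Encodable.encode d ::ᵥ List.Vector.nil).1).Dom
  rw [this]
  rfl

theorem trPosNum_eq (p : PosNum) : PartrecToTM2.trPosNum p =
    (Nat.bits (p : ℕ)).map (fun b => cond b PartrecToTM2.Γ'.bit1 PartrecToTM2.Γ'.bit0) := by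
  induction p with
  | one => simp [PartrecToTM2.trPosNum]
  | bit0 p ih => 
    have : (p:ℕ) ≠ 0 := (PosNum.cast_pos p).ne'
    simp [PartrecToTM2.trPosNum, ih, ← two_mul, Nat.bit0_bits _ this]
  | bit1 p ih => simp [PartrecToTM2.trPosNum, ih, ← two_mul, Nat.bit1_bits]

/-- Expresses the input tape through `Nat.bits`, so that the initial word can be seen to be
primitive recursive in `n`. -/
theorem trNat_eq (n : ℕ) : PartrecToTM2.trNat n =
    (Nat.bits n).map (fun b => cond b PartrecToTM2.Γ'.bit1 PartrecToTM2.Γ'.bit0) := by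
  unfold PartrecToTM2.trNat
  have h := Num.to_of_nat n
  generalize (n : Num) = m at h ⊢
  subst h
  cases m with
  | zero => simp [PartrecToTM2.trNum]
  | pos p => simpa [PartrecToTM2.trNum] using trPosNum_eq p

instance : Finite PartrecToTM2.K' :=
  Finite.of_surjective (fun i : Fin 4 => ![PartrecToTM2.K'.main, .rev, .aux, .stack] i)
    (fun k => by cases k <;> [use 0; use 1; use 2; use 3] <;> rfl)

/-- The program is compiled down to TM2, TM1 and TM0 machines. The type of machine states need not
be finite, but a finite set `S` supports the run; this is what later makes the automaton finite. The
first cell `a` holds the bottom marker of the stacks, and the word is reversed because the top of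
the stack comes last on the tape. -/
theorem exists_TM0_undecidable :
    ∃ (Γ Λ : Type) (_ : Inhabited Γ) (_ : Inhabited Λ) (_ : Finite Γ) (M : TM0.Machine Γ Λ)
      (S : Finset Λ) (a : Γ) (b : Bool → Γ), TM0.Supports M ↑S ∧
        ¬ ComputablePred fun n : ℕ => (TM0.eval M (a :: n.bits.reverse.map b)).Dom := by
  obtain ⟨c, hc⟩ := exists_code_undecidable
  let _ : Inhabited PartrecToTM2.Λ' := ⟨PartrecToTM2.trNormal c PartrecToTM2.Cont'.halt⟩
  have hsupp := PartrecToTM2.tr_supports c PartrecToTM2.Cont'.halt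
  refine ⟨_, _, inferInstance, inferInstance, ?_, TM1to0.tr (TM2to1.tr PartrecToTM2.tr), _, 
    (true, Function.update (fun _ => none) PartrecToTM2.K'.main (some .cons)),
    fun b => (false, Function.update (fun _ => none) PartrecToTM2.K'.main
      (some (cond b .bit1 .bit0))), TM1to0.tr_supports _ (TM2to1.tr_supports _ hsupp), ?_⟩
  · unfold TM2to1.Γ'; infer_instance
  · intro h
    refine hc (h.of_eq fun n => ?_)
    rw [TM1to0.tr_eval]
    have h1 := TM2to1.tr_eval_dom PartrecToTM2.tr PartrecToTM2.K'.main (PartrecToTM2.trList [n])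
    have h2 : (TM2to1.trInit (Γ := fun _ => PartrecToTM2.Γ') PartrecToTM2.K'.main
        (PartrecToTM2.trList [n])) = (true, Function.update (fun _ => none) PartrecToTM2.K'.main
          (some .cons)) :: n.bits.reverse.map fun b =>
            (false, Function.update (fun _ => none) PartrecToTM2.K'.main
              (some (cond b .bit1 .bit0))) := by
      have hrev : (PartrecToTM2.trList [n]).reverse =
          .cons :: n.bits.reverse.map fun b => cond b .bit1 .bit0 := by
        simp [trNat_eq]
      unfold TM2to1.trInit
      rw [hrev]
      exact congrArg (List.cons _) (List.map_map ..)
    refine (Iff.of_eq (congrArg (fun l => (TM1.eval (TM2to1.tr PartrecToTM2.tr) l).Dom)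
      h2.symm)).trans (h1.trans ?_)
    have h3 := PartrecToTM2.tr_eval c [n]
    have h4 : (TM2.eval PartrecToTM2.tr PartrecToTM2.K'.main (PartrecToTM2.trList [n])).Dom ↔
        (StateTransition.eval (TM2.step PartrecToTM2.tr) (PartrecToTM2.init c [n])).Dom := by
      have h5 : (TM2.init PartrecToTM2.K'.main (PartrecToTM2.trList [n]) :
          TM2.Cfg (fun _ : PartrecToTM2.K' => PartrecToTM2.Γ') PartrecToTM2.Λ'
            (Option PartrecToTM2.Γ')) = PartrecToTM2.init c [n] := by
        unfold TM2.init PartrecToTM2.init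
        congr 1
        funext k
        cases k <;> simp
      rw [← h5]
      rfl
    rw [h4, h3]
    rfl

/-- The space-time diagram of the cellular automaton with local rule `f` from the row `r`. -/
def caRun {K : Type*} (f : K → K → K → K) (r : ℤ → K) : ℕ → ℤ → K
  | 0 => r
  | i + 1 => fun z => f (caRun f r i (z - 1)) (caRun f r i z) (caRun f r i (z + 1))

/-- The two-way infinite row holding the word `w` at the positions `0, …, |w| - 1`. -/
def wordRow {K : Type*} (blank : K) (w : List K) : ℤ → K
  | Int.ofNat j => w.getD j blank
  | Int.negSucc _ => blank

/-! ### Simulation of a Turing machine by a cellular automaton. -/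

section MachineToAutomaton

variable {Γ Λ : Type} [Inhabited Γ] [Inhabited Λ] (M : TM0.Machine Γ Λ)

/-- The state in which the head leaves the cell `c` in direction `d`, if it does. -/
def tmLeaves (d : Dir) (c : Γ × Option Λ) : Option Λ :=
  c.2.bind fun q => (M q c.1).bind fun s =>
    match s.2 with
    | .move d' => if d' = d then some s.1 else none
    | .write _ => none

/-- The local rule simulating a Turing machine; a cell holds a symbol and possibly the head. -/
def tmRule (l m r : Γ × Option Λ) : Γ × Option Λ :=
  match m.2 with
  | some q =>
    match M q m.1 with
    | none => (m.1, none)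
    | some (q', .write b) => (b, some q')
    | some (_, .move _) => (m.1, none)
  | none => (m.1, (tmLeaves M .right l).or (tmLeaves M .left r))

/-- The row of cells describing a configuration whose head is at position `p`. -/
def tmRow (c : TM0.Cfg Γ Λ) (p z : ℤ) : Γ × Option Λ :=
  (c.Tape.nth (z - p), if z = p then some c.q else none)

/-- Only the head cell and its two neighbours can change. A tape is indexed relative to its head, so
a move shifts the tape and the head position `p` together and leaves the absolute contents fixed. -/
theorem tmRow_step {c c' : TM0.Cfg Γ Λ} (h : TM0.step M c = some c') (p : ℤ) :
    ∃ p', ∀ z, tmRow c' p' z = tmRule M (tmRow c p (z - 1)) (tmRow c p z) (tmRow c p (z + 1)) := by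
  obtain ⟨q, T⟩ := c
  simp only [TM0.step, Option.map_eq_some_iff] at h
  obtain ⟨⟨q', s⟩, hM, rfl⟩ := h
  have key : ∀ z : ℤ, z = p - 1 ∨ z = p ∨ z = p + 1 ∨
      (z ≠ p ∧ z - 1 ≠ p ∧ z + 1 ≠ p) := by omega
  cases s with
  | write b =>
    refine ⟨p, fun z => ?_⟩
    rcases key z with rfl | rfl | rfl | ⟨h1, h2, h3⟩
    · simp [tmRow, tmRule, tmLeaves, hM, show p - 1 - 1 ≠ p by omega]
    · simp [tmRow, tmRule, hM, Tape.write]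
    · simp [tmRow, tmRule, tmLeaves, hM, show p + 1 + 1 ≠ p by omega]
    · simp [tmRow, tmRule, tmLeaves, h1, h2, h3, sub_eq_zero]
  | move d =>
    cases d with
    | left =>
      refine ⟨p - 1, fun z => ?_⟩
      rcases key z with rfl | rfl | rfl | ⟨h1, h2, h3⟩
      · simp [tmRow, tmRule, tmLeaves, hM, show p - 1 - 1 ≠ p by omega]
        rw [← Tape.nth_zero, Tape.move_left_nth, zero_sub]
      · simp [tmRow, tmRule, hM, show z ≠ z - 1 by omega]
      · simp [tmRow, tmRule, tmLeaves, hM, show p + 1 + 1 ≠ p by omega,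
          show p + 1 ≠ p - 1 by omega]
      · simp [tmRow, tmRule, tmLeaves, h1, h2, h3, show z ≠ p - 1 by omega]
        congr 1; ring
    | right =>
      refine ⟨p + 1, fun z => ?_⟩
      rcases key z with rfl | rfl | rfl | ⟨h1, h2, h3⟩
      · simp [tmRow, tmRule, tmLeaves, hM, show p - 1 - 1 ≠ p by omega,
          show p - 1 ≠ p + 1 by omega]
        congr 1; ring
      · simp [tmRow, tmRule, hM]
      · simp [tmRow, tmRule, tmLeaves, hM, show p + 1 + 1 ≠ p by omega]
        rw [← Tape.nth_zero, Tape.move_right_nth, zero_add]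
      · simp [tmRow, tmRule, tmLeaves, h1, h2, h3, show z ≠ p + 1 by omega]
        congr 1; ring

/-- The cell holds the head of a machine that halts there. -/
def tmHalts (c : Γ × Option Λ) : Prop := ∃ q, c.2 = some q ∧ M q c.1 = none

theorem tmHalts_row {c : TM0.Cfg Γ Λ} {p : ℤ} :
    (∃ z, tmHalts M (tmRow c p z)) ↔ TM0.step M c = none := by
  obtain ⟨q, T⟩ := c
  constructor
  · rintro ⟨z, q', h1, h2⟩
    obtain rfl | hz := eq_or_ne z p
    · simp [tmRow] at h1 h2
      simp [TM0.step, h1, h2]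
    · simp [tmRow, hz] at h1
  · intro h
    refine ⟨p, q, by simp [tmRow], ?_⟩
    simpa [TM0.step, tmRow] using h

/-- Rows describe configurations until the machine halts, after which the rule erases the head. The
converse direction therefore assumes that no halting configuration is reachable, so that every row
describes one. -/
theorem tm_dom_iff (l : List Γ) (r : ℤ → Γ × Option Λ) (hr : r = tmRow (TM0.init l) 0) :
    (TM0.eval M l).Dom ↔ ∃ i z, tmHalts M (caRun (tmRule M) r i z) := by
  subst hr
  change (StateTransition.eval (TM0.step M) (TM0.init l)).Dom ↔ _
  rw [Part.dom_iff_mem]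
  simp only [StateTransition.mem_eval]
  constructor
  · rintro ⟨c, hc, hhalt⟩
    have : ∃ i p, caRun (tmRule M) (tmRow (TM0.init l) 0) i = tmRow c p := by
      clear hhalt
      induction hc with
      | refl => exact ⟨0, 0, rfl⟩
      | tail _ hs ih =>
        obtain ⟨i, p, ih⟩ := ih
        obtain ⟨p', hp'⟩ := tmRow_step M hs p
        exact ⟨i + 1, p', funext fun z => by rw [hp', caRun, ih]⟩
    obtain ⟨i, p, h⟩ := this
    obtain ⟨z, hz⟩ := (tmHalts_row M (p := p)).2 hhalt
    exact ⟨i, z, by rwa [h]⟩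
  · rintro ⟨i, z, hz⟩
    by_contra hno
    have : ∀ i, ∃ c p, StateTransition.Reaches (TM0.step M) (TM0.init l) c ∧
        caRun (tmRule M) (tmRow (TM0.init l) 0) i = tmRow c p := by
      intro i
      induction i with
      | zero => exact ⟨_, 0, .refl, rfl⟩
      | succ i ih =>
        obtain ⟨c, p, hc, ih⟩ := ih
        cases hs : TM0.step M c with
        | none => exact (hno ⟨c, hc, hs⟩).elim
        | some c' =>
          obtain ⟨p', hp'⟩ := tmRow_step M hs p
          exact ⟨c', p', hc.tail hs, funext fun z => by rw [hp', caRun, ih]⟩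
    obtain ⟨c, p, hc, h⟩ := this i
    rw [h] at hz
    exact hno ⟨c, hc, (tmHalts_row M).1 ⟨z, hz⟩⟩

theorem tmRow_init (a : Γ) (l : List Γ) :
    tmRow (TM0.init (a :: l) : TM0.Cfg Γ Λ) 0 =
      wordRow (default, none) ((a, some default) :: l.map fun b => (b, none)) := by
  funext z
  rcases z with (_ | j) | j
  · simp [tmRow, wordRow, TM0.init, Tape.mk₁, Tape.mk₂, Tape.mk', Tape.nth]
  · simp [tmRow, wordRow, TM0.init, Tape.mk₁, Tape.mk₂, Tape.mk', Tape.nth]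
    exact ⟨List.getI_eq_getElem?_getD .., by omega⟩
  · simp [tmRow, wordRow, TM0.init, Tape.mk₁, Tape.mk₂, Tape.mk', Tape.nth]

omit [Inhabited Γ] in
theorem tmRule_mem {S : Finset Λ} (hS : TM0.Supports M ↑S) {l m r : Γ × Option Λ}
    (hl : ∀ q ∈ l.2, q ∈ S) (hm : ∀ q ∈ m.2, q ∈ S) (hr : ∀ q ∈ r.2, q ∈ S) :
    ∀ q ∈ (tmRule M l m r).2, q ∈ S := by
  have leaves : ∀ (d : Dir) (c : Γ × Option Λ), (∀ q ∈ c.2, q ∈ S) →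
      ∀ q ∈ tmLeaves M d c, q ∈ S := by
    rintro d ⟨a, _ | q₀⟩ hc q hq
    · simp [tmLeaves] at hq
    · simp only [tmLeaves, Option.bind_some, Option.mem_def, Option.bind_eq_some_iff] at hq
      obtain ⟨⟨q', s⟩, hs, hq⟩ := hq
      have := hS.2 hs (hc q₀ rfl)
      cases s <;> simp at hq
      rw [← hq.2]; exact this
  obtain ⟨a, _ | q₀⟩ := m
  · intro q hq
    simp only [tmRule, Option.mem_def, Option.or_eq_some_iff] at hq
    rcases hq with hq | ⟨-, hq⟩
    · exact leaves _ _ hl _ hq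
    · exact leaves _ _ hr _ hq
  · simp only [tmRule]
    split
    · simp
    · rename_i h
      simpa using hS.2 h (hm q₀ rfl)
    · simp

theorem caRun_mem {K : Type*} {f : K → K → K → K} {X : Set K}
    (hf : ∀ l ∈ X, ∀ m ∈ X, ∀ r ∈ X, f l m r ∈ X) {r : ℤ → K} (hr : ∀ z, r z ∈ X) :
    ∀ i z, caRun f r i z ∈ X
  | 0, _ => hr _
  | i + 1, _ => hf _ (caRun_mem hf hr i _) _ (caRun_mem hf hr i _) _ (caRun_mem hf hr i _)

/-- Allows the states to be renamed by `Fin κ`: the decoder need only be correct on a set `X` closed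
under the rule. -/
theorem caRun_encode {K K' : Type*} {f : K → K → K → K} {X : Set K}
    (hf : ∀ l ∈ X, ∀ m ∈ X, ∀ r ∈ X, f l m r ∈ X) {r : ℤ → K} (hr : ∀ z, r z ∈ X)
    {enc : K → K'} {dec : K' → K} (h : ∀ x ∈ X, dec (enc x) = x) (i : ℕ) (z : ℤ) :
    caRun (fun a b c => enc (f (dec a) (dec b) (dec c))) (fun z => enc (r z)) i z =
      enc (caRun f r i z) := by
  induction i generalizing z with
  | zero => rfl
  | succ i ih => simp only [caRun, ih, h _ (caRun_mem hf hr i _)]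

theorem wordRow_map {K K' : Type*} (e : K → K') (blank : K) (w : List K) (z : ℤ) :
    wordRow (e blank) (w.map e) z = e (wordRow blank w z) := by
  cases z
  · simp only [wordRow, List.getD_map]
  · rfl

theorem exists_fin_encoding {K : Type*} [Nonempty K] {X : Set K} (hX : X.Finite) :
    ∃ (κ : ℕ) (enc : K → Fin κ) (dec : Fin κ → K), ∀ x ∈ X, dec (enc x) = x := by
  classical
  obtain ⟨x₀⟩ := ‹Nonempty K›
  have : Finite ↥(insert x₀ X) := (hX.insert x₀).to_subtype
  obtain ⟨κ, ⟨e⟩⟩ := Finite.exists_equiv_fin ↥(insert x₀ X)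
  refine ⟨κ, fun x => e (if h : x ∈ insert x₀ X then ⟨x, h⟩ else ⟨x₀, Set.mem_insert _ _⟩),
    fun i => e.symm i, fun x hx => ?_⟩
  have : x ∈ insert x₀ X := Set.mem_insert_of_mem _ hx
  simp [this]

/-- Course-of-values recursion: the parity of `n` is put in front of the bits of `n / 2`, and the
length of the list of earlier values is `n`. -/
theorem primrec_bits : Primrec Nat.bits := by
  refine (Primrec.nat_strong_rec (α := Unit) (fun _ n => Nat.bits n)
    (g := fun _ l => some (if l.length = 0 then [] else
      (decide (l.length % 2 = 1)) :: l.getD (l.length / 2) [])) ?_ ?_).comp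
      (Primrec.const ()) Primrec.id
  · have hl : Primrec fun p : Unit × List (List Bool) => p.2.length :=
      Primrec.list_length.comp Primrec.snd
    refine Primrec.option_some.comp (Primrec.ite (Primrec.eq.comp hl (Primrec.const 0))
      (Primrec.const []) (Primrec.list_cons.comp ?_ ?_))
    · exact (Primrec.eq.comp (Primrec.nat_mod.comp hl (Primrec.const 2)) (Primrec.const 1)).decide
    · exact (Primrec.list_getD []).comp Primrec.snd (Primrec.nat_div.comp hl (Primrec.const 2))
  · intro _ n
    obtain rfl | hn := eq_or_ne n 0
    · simp
    · have h2 : n / 2 < n := by omega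
      simp only [List.length_map, List.length_range, hn, if_false, Option.some.injEq]
      rw [List.getD_eq_getElem _ _ (by simpa using h2)]
      simp only [List.getElem_map, List.getElem_range]
      conv_rhs => rw [← Nat.div_add_mod n 2]
      rcases Nat.mod_two_eq_zero_or_one n with h | h
      · rw [h, Nat.add_zero, Nat.bit0_bits _ (by omega)]; rfl
      · rw [h, Nat.bit1_bits]; rfl

end MachineToAutomaton

/-- A cellular automaton for which it is undecidable, given an initial word, whether a cell ever
enters a given set of states. -/
theorem exists_automaton_undecidable :
    ∃ (κ : ℕ) (f : Fin κ → Fin κ → Fin κ → Fin κ) (H : Set (Fin κ)) (blank : Fin κ)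
      (w : ℕ → List (Fin κ)), Primrec w ∧
        ¬ ComputablePred fun n => ∃ i z, caRun f (wordRow blank (w n)) i z ∈ H := by
  obtain ⟨Γ, Λ, _, _, _, M, S, a, b, hS, hM⟩ := exists_TM0_undecidable
  let X : Set (Γ × Option Λ) := {c | ∀ q ∈ c.2, q ∈ S}
  have hX : X.Finite := by
    refine ((Set.finite_univ (α := Γ)).prod (Finset.insertNone S).finite_toSet).subset ?_
    rintro c hc
    exact ⟨trivial, by simpa using (show ∀ q ∈ c.2, q ∈ S from hc)⟩
  obtain ⟨κ, enc, dec, hdec⟩ := exists_fin_encoding hX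
  have hf : ∀ l ∈ X, ∀ m ∈ X, ∀ r ∈ X, tmRule M l m r ∈ X :=
    fun l hl m hm r hr => tmRule_mem M hS hl hm hr
  refine ⟨κ, fun x y z => enc (tmRule M (dec x) (dec y) (dec z)), {x | tmHalts M (dec x)},
    enc (default, none), fun n => enc (a, some default) :: n.bits.reverse.map
      fun c => enc (b c, none), ?_, fun h => hM (h.of_eq fun n => ?_)⟩
  · exact Primrec.list_cons.comp (Primrec.const _) (Primrec.list_map
      (Primrec.list_reverse.comp primrec_bits)
      ((Primrec.dom_finite fun c => enc (b c, none)).comp Primrec.snd))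
  · have hrow := tmRow_init (Λ := Λ) a (n.bits.reverse.map b)
    rw [tm_dom_iff M _ _ hrow.symm]
    have hr : ∀ z, wordRow (default, none) ((a, some default) ::
        (n.bits.reverse.map b).map fun c => (c, (none : Option Λ))) z ∈ X := by
      intro z
      rw [← hrow]
      intro q hq
      simp only [tmRow, Option.mem_def] at hq
      split at hq
      · cases hq; exact hS.1
      · cases hq
    have : (enc (a, some default) :: n.bits.reverse.map fun c => enc (b c, none)) =
        (((a, some default) :: (n.bits.reverse.map b).map fun c => (c, (none : Option Λ))) :
          List (Γ × Option Λ)).map enc := by simp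
    simp only [this, Set.mem_ofPred_eq]
    refine exists_congr fun i => exists_congr fun z => ?_
    rw [funext (wordRow_map enc (default, none) _), caRun_encode hf hr hdec,
      hdec _ (caRun_mem hf hr i z)]

end

/-- The base relations `S, Time, RightGen, LeftGen, Next, Label, Or`, and the closure `S⁺`. -/
def gridSig (m : ℕ) : TCSignature where
  numBase := 7
  numDist := 1
  baseArity := ![2, 3, 5, 5, 2, 4, m]
  under := fun _ => 0
  under_injective := fun _ _ _ => Subsingleton.elim _ _
  under_binary := fun _ => rfl

/-! ### Atoms over the grid signature. -/

namespace Grid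

variable {m : ℕ} {A : Type*}

def step (x y : A) : RelFact (gridSig m) A := ⟨.inl (0 : Fin 7), (![x, y] : Fin 2 → A)⟩
def time (x y t : A) : RelFact (gridSig m) A := ⟨.inl (1 : Fin 7), (![x, y, t] : Fin 3 → A)⟩
def rightGen (x y t u v : A) : RelFact (gridSig m) A :=
  ⟨.inl (2 : Fin 7), (![x, y, t, u, v] : Fin 5 → A)⟩
def leftGen (x y t u v : A) : RelFact (gridSig m) A :=
  ⟨.inl (3 : Fin 7), (![x, y, t, u, v] : Fin 5 → A)⟩
def next (x y : A) : RelFact (gridSig m) A := ⟨.inl (4 : Fin 7), (![x, y] : Fin 2 → A)⟩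
def label (x y u v : A) : RelFact (gridSig m) A := ⟨.inl (5 : Fin 7), (![x, y, u, v] : Fin 4 → A)⟩
def disj (t : Fin m → A) : RelFact (gridSig m) A := ⟨.inl (6 : Fin 7), t⟩
def reach (x y : A) : RelFact (gridSig m) A := ⟨.inr (0 : Fin 1), (![x, y] : Fin 2 → A)⟩

section Map
variable {B : Type*} (h : A → B)

theorem map_step (x y : A) : (step x y : RelFact (gridSig m) A).map h = step (h x) (h y) :=
  congrArg (RelFact.mk _) (FinVec.map_eq h ![x, y]).symm
theorem map_time (x y t : A) :
    (time x y t : RelFact (gridSig m) A).map h = time (h x) (h y) (h t) :=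
  congrArg (RelFact.mk _) (FinVec.map_eq h ![x, y, t]).symm
theorem map_rightGen (x y t u v : A) : (rightGen x y t u v : RelFact (gridSig m) A).map h =
    rightGen (h x) (h y) (h t) (h u) (h v) :=
  congrArg (RelFact.mk _) (FinVec.map_eq h ![x, y, t, u, v]).symm
theorem map_leftGen (x y t u v : A) : (leftGen x y t u v : RelFact (gridSig m) A).map h =
    leftGen (h x) (h y) (h t) (h u) (h v) :=
  congrArg (RelFact.mk _) (FinVec.map_eq h ![x, y, t, u, v]).symm
theorem map_next (x y : A) : (next x y : RelFact (gridSig m) A).map h = next (h x) (h y) :=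
  congrArg (RelFact.mk _) (FinVec.map_eq h ![x, y]).symm
theorem map_label (x y u v : A) :
    (label x y u v : RelFact (gridSig m) A).map h = label (h x) (h y) (h u) (h v) :=
  congrArg (RelFact.mk _) (FinVec.map_eq h ![x, y, u, v]).symm
theorem map_disj (t : Fin m → A) :
    (disj t : RelFact (gridSig m) A).map h = disj (h ∘ t) := rfl

end Map

theorem respectsTC_iff {F : Set (RelFact (gridSig m) A)} :
    RespectsTC F ↔ ∀ a b, reach a b ∈ F ↔ Relation.TransGen (fun x y => step x y ∈ F) a b :=
  ⟨fun h => h (0 : Fin 1), fun h d => by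
    obtain rfl : d = (0 : Fin 1) := Subsingleton.elim (α := Fin 1) _ _
    exact h⟩

end Grid

/-- Since no variable repeats in an atom, every tuple of elements is an instance of it; assignments
can thus be traded for tuples. -/
theorem InclDep.holds_iff {σ : TCSignature} {A : Type*} [Nonempty A] (τ : InclDep σ)
    (F : Set (RelFact σ A)) :
    τ.Holds F ↔ ∀ v : Fin (σ.arity τ.body.rel) → A, ⟨τ.body.rel, v⟩ ∈ F →
      ∃ w : Fin (σ.arity τ.head.rel) → A,
        (∀ i j, τ.body.args i = τ.head.args j → w j = v i) ∧ ⟨τ.head.rel, w⟩ ∈ F := by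
  obtain ⟨a⟩ := ‹Nonempty A›
  constructor
  · intro h v hv
    have hg : Function.extend τ.body.args v (fun _ => a) ∘ τ.body.args = v :=
      funext fun i => τ.body_injective.extend_apply _ _ i
    obtain ⟨h', h1, h2⟩ := h (Function.extend τ.body.args v fun _ => a)
      (by rw [show τ.body.map _ = _ from congrArg (RelFact.mk _) hg]; exact hv)
    refine ⟨h' ∘ τ.head.args, fun i j hij => ?_, h2⟩
    rw [Function.comp_apply, ← hij, h1 _ ⟨i, rfl⟩]
    exact congrFun hg i
  · intro h g hg
    obtain ⟨w, h1, h2⟩ := h _ hg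
    have hw : Function.extend τ.head.args w g ∘ τ.head.args = w :=
      funext fun i => τ.head_injective.extend_apply _ _ i
    refine ⟨Function.extend τ.head.args w g, ?_, ?_⟩
    · rintro _ ⟨i, rfl⟩
      by_cases hi : ∃ j, τ.head.args j = τ.body.args i
      · obtain ⟨j, hj⟩ := hi
        rw [← h1 i j hj.symm, ← hj]
        exact congrFun hw j
      · exact Function.extend_apply' _ _ _ hi
    · rw [show τ.head.map _ = _ from congrArg (RelFact.mk _) hw]
      exact h2

/-! ### The inclusion dependencies and their meaning. -/

namespace Grid

variable {m : ℕ} {A : Type*}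

theorem step_eta (v : Fin 2 → A) :
    (step (v 0) (v 1) : RelFact (gridSig m) A) = ⟨.inl (0 : Fin 7), v⟩ :=
  congrArg (RelFact.mk _) (FinVec.etaExpand_eq v)

theorem time_eta (v : Fin 3 → A) :
    (time (v 0) (v 1) (v 2) : RelFact (gridSig m) A) = ⟨.inl (1 : Fin 7), v⟩ :=
  congrArg (RelFact.mk _) (FinVec.etaExpand_eq v)

theorem rightGen_eta (v : Fin 5 → A) :
    (rightGen (v 0) (v 1) (v 2) (v 3) (v 4) : RelFact (gridSig m) A) = ⟨.inl (2 : Fin 7), v⟩ :=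
  congrArg (RelFact.mk _) (FinVec.etaExpand_eq v)

theorem leftGen_eta (v : Fin 5 → A) :
    (leftGen (v 0) (v 1) (v 2) (v 3) (v 4) : RelFact (gridSig m) A) = ⟨.inl (3 : Fin 7), v⟩ :=
  congrArg (RelFact.mk _) (FinVec.etaExpand_eq v)

theorem next_eta (v : Fin 2 → A) :
    (next (v 0) (v 1) : RelFact (gridSig m) A) = ⟨.inl (4 : Fin 7), v⟩ :=
  congrArg (RelFact.mk _) (FinVec.etaExpand_eq v)

theorem label_eta (v : Fin 4 → A) :
    (label (v 0) (v 1) (v 2) (v 3) : RelFact (gridSig m) A) = ⟨.inl (5 : Fin 7), v⟩ :=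
  congrArg (RelFact.mk _) (FinVec.etaExpand_eq v)

theorem reach_eta (v : Fin 2 → A) :
    (reach (v 0) (v 1) : RelFact (gridSig m) A) = ⟨.inr (0 : Fin 1), v⟩ :=
  congrArg (RelFact.mk _) (FinVec.etaExpand_eq v)

/-! The inclusion dependencies, in three groups: labels of reachable pairs, the backward time
line, and the two rays of tape positions whose initial labels are carried along. -/

/-- Together with `labelReach` this simulates a choice: the new pair must lie in S⁺, and the length
of a witnessing path is free. -/
def reachLabel (m : ℕ) : InclDep (gridSig m) where
  body := reach 0 1
  head := label 0 1 2 3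
  body_injective := show Function.Injective (![0, 1] : Fin 2 → ℕ) by decide
  head_injective := show Function.Injective (![0, 1, 2, 3] : Fin 4 → ℕ) by decide

theorem reachLabel_holds_iff [Nonempty A] {F : Set (RelFact (gridSig m) A)} :
    (reachLabel m).Holds F ↔ ∀ x y, reach x y ∈ F → ∃ p q, label x y p q ∈ F := by
  rw [InclDep.holds_iff]
  constructor
  · intro h x y hb
    obtain ⟨w, h1, h2⟩ := h (![x, y] : Fin 2 → A) hb
    change ∀ (i : Fin 2) (j : Fin 4), _ → _ at h1
    change Fin 4 → A at w
    have key : label (w 0) (w 1) (w 2) (w 3) ∈ F := by rw [label_eta]; exact h2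
    rw [show w 0 = x from h1 0 0 rfl, show w 1 = y from h1 1 1 rfl] at key
    exact ⟨w 2, w 3, key⟩
  · intro h v hv
    change Fin 2 → A at v
    have hb : reach (v 0) (v 1) ∈ F := by rw [reach_eta]; exact hv
    obtain ⟨p, q, h2⟩ := h _ _ hb
    refine ⟨(![v 0, v 1, p, q] : Fin 4 → A), ?_, h2⟩
    exact fun (i : Fin 2) (j : Fin 4) hij => by
      change (![0, 1] : Fin 2 → ℕ) i = (![0, 1, 2, 3] : Fin 4 → ℕ) j at hij
      fin_cases i <;> fin_cases j <;> first | rfl | cases hij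

def labelReach (m : ℕ) : InclDep (gridSig m) where
  body := label 0 1 2 3
  head := reach 2 3
  body_injective := show Function.Injective (![0, 1, 2, 3] : Fin 4 → ℕ) by decide
  head_injective := show Function.Injective (![2, 3] : Fin 2 → ℕ) by decide

theorem labelReach_holds_iff [Nonempty A] {F : Set (RelFact (gridSig m) A)} :
    (labelReach m).Holds F ↔ ∀ x y z s, label x y z s ∈ F → reach z s ∈ F := by
  rw [InclDep.holds_iff]
  constructor
  · intro h x y z s hb
    obtain ⟨w, h1, h2⟩ := h (![x, y, z, s] : Fin 4 → A) hb
    change ∀ (i : Fin 4) (j : Fin 2), _ → _ at h1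
    change Fin 2 → A at w
    have key : reach (w 0) (w 1) ∈ F := by rw [reach_eta]; exact h2
    rw [show w 0 = z from h1 2 0 rfl, show w 1 = s from h1 3 1 rfl] at key
    exact key
  · intro h v hv
    change Fin 4 → A at v
    have hb : label (v 0) (v 1) (v 2) (v 3) ∈ F := by rw [label_eta]; exact hv
    have h2 := h _ _ _ _ hb
    refine ⟨(![v 2, v 3] : Fin 2 → A), ?_, h2⟩
    exact fun (i : Fin 4) (j : Fin 2) hij => by
      change (![0, 1, 2, 3] : Fin 4 → ℕ) i = (![2, 3] : Fin 2 → ℕ) j at hij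
      fin_cases i <;> fin_cases j <;> first | rfl | cases hij

def timeStep (m : ℕ) : InclDep (gridSig m) where
  body := time 0 1 2
  head := step 0 1
  body_injective := show Function.Injective (![0, 1, 2] : Fin 3 → ℕ) by decide
  head_injective := show Function.Injective (![0, 1] : Fin 2 → ℕ) by decide

theorem timeStep_holds_iff [Nonempty A] {F : Set (RelFact (gridSig m) A)} :
    (timeStep m).Holds F ↔ ∀ x y z, time x y z ∈ F → step x y ∈ F := by
  rw [InclDep.holds_iff]
  constructor
  · intro h x y z hb
    obtain ⟨w, h1, h2⟩ := h (![x, y, z] : Fin 3 → A) hb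
    change ∀ (i : Fin 3) (j : Fin 2), _ → _ at h1
    change Fin 2 → A at w
    have key : step (w 0) (w 1) ∈ F := by rw [step_eta]; exact h2
    rw [show w 0 = x from h1 0 0 rfl, show w 1 = y from h1 1 1 rfl] at key
    exact key
  · intro h v hv
    change Fin 3 → A at v
    have hb : time (v 0) (v 1) (v 2) ∈ F := by rw [time_eta]; exact hv
    have h2 := h _ _ _ hb
    refine ⟨(![v 0, v 1] : Fin 2 → A), ?_, h2⟩
    exact fun (i : Fin 3) (j : Fin 2) hij => by
      change (![0, 1, 2] : Fin 3 → ℕ) i = (![0, 1] : Fin 2 → ℕ) j at hij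
      fin_cases i <;> fin_cases j <;> first | rfl | cases hij

/-- The new instant precedes the old one, so S leads from every time down to the origin. The third
argument transports the flag, since dependencies cannot mention constants. -/
def timeNew (m : ℕ) : InclDep (gridSig m) where
  body := time 0 1 2
  head := time 3 0 2
  body_injective := show Function.Injective (![0, 1, 2] : Fin 3 → ℕ) by decide
  head_injective := show Function.Injective (![3, 0, 2] : Fin 3 → ℕ) by decide

theorem timeNew_holds_iff [Nonempty A] {F : Set (RelFact (gridSig m) A)} :
    (timeNew m).Holds F ↔ ∀ x y z, time x y z ∈ F → ∃ p, time p x z ∈ F := by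
  rw [InclDep.holds_iff]
  constructor
  · intro h x y z hb
    obtain ⟨w, h1, h2⟩ := h (![x, y, z] : Fin 3 → A) hb
    change ∀ (i : Fin 3) (j : Fin 3), _ → _ at h1
    change Fin 3 → A at w
    have key : time (w 0) (w 1) (w 2) ∈ F := by rw [time_eta]; exact h2
    rw [show w 1 = x from h1 0 1 rfl, show w 2 = z from h1 2 2 rfl] at key
    exact ⟨w 0, key⟩
  · intro h v hv
    change Fin 3 → A at v
    have hb : time (v 0) (v 1) (v 2) ∈ F := by rw [time_eta]; exact hv
    obtain ⟨p, h2⟩ := h _ _ _ hb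
    refine ⟨(![p, v 0, v 2] : Fin 3 → A), ?_, h2⟩
    exact fun (i : Fin 3) (j : Fin 3) hij => by
      change (![0, 1, 2] : Fin 3 → ℕ) i = (![3, 0, 2] : Fin 3 → ℕ) j at hij
      fin_cases i <;> fin_cases j <;> first | rfl | cases hij

def rightStep (m : ℕ) : InclDep (gridSig m) where
  body := rightGen 0 1 2 3 4
  head := step 0 1
  body_injective := show Function.Injective (![0, 1, 2, 3, 4] : Fin 5 → ℕ) by decide
  head_injective := show Function.Injective (![0, 1] : Fin 2 → ℕ) by decide

theorem rightStep_holds_iff [Nonempty A] {F : Set (RelFact (gridSig m) A)} :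
    (rightStep m).Holds F ↔ ∀ x y z s t, rightGen x y z s t ∈ F → step x y ∈ F := by
  rw [InclDep.holds_iff]
  constructor
  · intro h x y z s t hb
    obtain ⟨w, h1, h2⟩ := h (![x, y, z, s, t] : Fin 5 → A) hb
    change ∀ (i : Fin 5) (j : Fin 2), _ → _ at h1
    change Fin 2 → A at w
    have key : step (w 0) (w 1) ∈ F := by rw [step_eta]; exact h2
    rw [show w 0 = x from h1 0 0 rfl, show w 1 = y from h1 1 1 rfl] at key
    exact key
  · intro h v hv
    change Fin 5 → A at v
    have hb : rightGen (v 0) (v 1) (v 2) (v 3) (v 4) ∈ F := by rw [rightGen_eta]; exact hv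
    have h2 := h _ _ _ _ _ hb
    refine ⟨(![v 0, v 1] : Fin 2 → A), ?_, h2⟩
    exact fun (i : Fin 5) (j : Fin 2) hij => by
      change (![0, 1, 2, 3, 4] : Fin 5 → ℕ) i = (![0, 1] : Fin 2 → ℕ) j at hij
      fin_cases i <;> fin_cases j <;> first | rfl | cases hij

def rightNext (m : ℕ) : InclDep (gridSig m) where
  body := rightGen 0 1 2 3 4
  head := next 0 1
  body_injective := show Function.Injective (![0, 1, 2, 3, 4] : Fin 5 → ℕ) by decide
  head_injective := show Function.Injective (![0, 1] : Fin 2 → ℕ) by decide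

theorem rightNext_holds_iff [Nonempty A] {F : Set (RelFact (gridSig m) A)} :
    (rightNext m).Holds F ↔ ∀ x y z s t, rightGen x y z s t ∈ F → next x y ∈ F := by
  rw [InclDep.holds_iff]
  constructor
  · intro h x y z s t hb
    obtain ⟨w, h1, h2⟩ := h (![x, y, z, s, t] : Fin 5 → A) hb
    change ∀ (i : Fin 5) (j : Fin 2), _ → _ at h1
    change Fin 2 → A at w
    have key : next (w 0) (w 1) ∈ F := by rw [next_eta]; exact h2
    rw [show w 0 = x from h1 0 0 rfl, show w 1 = y from h1 1 1 rfl] at key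
    exact key
  · intro h v hv
    change Fin 5 → A at v
    have hb : rightGen (v 0) (v 1) (v 2) (v 3) (v 4) ∈ F := by rw [rightGen_eta]; exact hv
    have h2 := h _ _ _ _ _ hb
    refine ⟨(![v 0, v 1] : Fin 2 → A), ?_, h2⟩
    exact fun (i : Fin 5) (j : Fin 2) hij => by
      change (![0, 1, 2, 3, 4] : Fin 5 → ℕ) i = (![0, 1] : Fin 2 → ℕ) j at hij
      fin_cases i <;> fin_cases j <;> first | rfl | cases hij

/-- The carried arguments are meant to be the origin of time and the two ends of the path coding the
blank. Only the end point of an edge is labelled, so the start of the ray needs a fact of its own.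
-/
def rightLabel (m : ℕ) : InclDep (gridSig m) where
  body := rightGen 0 1 2 3 4
  head := label 2 1 3 4
  body_injective := show Function.Injective (![0, 1, 2, 3, 4] : Fin 5 → ℕ) by decide
  head_injective := show Function.Injective (![2, 1, 3, 4] : Fin 4 → ℕ) by decide

theorem rightLabel_holds_iff [Nonempty A] {F : Set (RelFact (gridSig m) A)} :
    (rightLabel m).Holds F ↔ ∀ x y z s t, rightGen x y z s t ∈ F → label z y s t ∈ F := by
  rw [InclDep.holds_iff]
  constructor
  · intro h x y z s t hb
    obtain ⟨w, h1, h2⟩ := h (![x, y, z, s, t] : Fin 5 → A) hb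
    change ∀ (i : Fin 5) (j : Fin 4), _ → _ at h1
    change Fin 4 → A at w
    have key : label (w 0) (w 1) (w 2) (w 3) ∈ F := by rw [label_eta]; exact h2
    rw [show w 0 = z from h1 2 0 rfl, show w 1 = y from h1 1 1 rfl,
      show w 2 = s from h1 3 2 rfl, show w 3 = t from h1 4 3 rfl] at key
    exact key
  · intro h v hv
    change Fin 5 → A at v
    have hb : rightGen (v 0) (v 1) (v 2) (v 3) (v 4) ∈ F := by rw [rightGen_eta]; exact hv
    have h2 := h _ _ _ _ _ hb
    refine ⟨(![v 2, v 1, v 3, v 4] : Fin 4 → A), ?_, h2⟩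
    exact fun (i : Fin 5) (j : Fin 4) hij => by
      change (![0, 1, 2, 3, 4] : Fin 5 → ℕ) i = (![2, 1, 3, 4] : Fin 4 → ℕ) j at hij
      fin_cases i <;> fin_cases j <;> first | rfl | cases hij

def rightNew (m : ℕ) : InclDep (gridSig m) where
  body := rightGen 0 1 2 3 4
  head := rightGen 1 5 2 3 4
  body_injective := show Function.Injective (![0, 1, 2, 3, 4] : Fin 5 → ℕ) by decide
  head_injective := show Function.Injective (![1, 5, 2, 3, 4] : Fin 5 → ℕ) by decide

theorem rightNew_holds_iff [Nonempty A] {F : Set (RelFact (gridSig m) A)} :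
    (rightNew m).Holds F ↔ ∀ x y z s t, rightGen x y z s t ∈ F → ∃ p, rightGen y p z s t ∈ F := by
  rw [InclDep.holds_iff]
  constructor
  · intro h x y z s t hb
    obtain ⟨w, h1, h2⟩ := h (![x, y, z, s, t] : Fin 5 → A) hb
    change ∀ (i : Fin 5) (j : Fin 5), _ → _ at h1
    change Fin 5 → A at w
    have key : rightGen (w 0) (w 1) (w 2) (w 3) (w 4) ∈ F := by rw [rightGen_eta]; exact h2
    rw [show w 0 = y from h1 1 0 rfl, show w 2 = z from h1 2 2 rfl,
      show w 3 = s from h1 3 3 rfl, show w 4 = t from h1 4 4 rfl] at key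
    exact ⟨w 1, key⟩
  · intro h v hv
    change Fin 5 → A at v
    have hb : rightGen (v 0) (v 1) (v 2) (v 3) (v 4) ∈ F := by rw [rightGen_eta]; exact hv
    obtain ⟨p, h2⟩ := h _ _ _ _ _ hb
    refine ⟨(![v 1, p, v 2, v 3, v 4] : Fin 5 → A), ?_, h2⟩
    exact fun (i : Fin 5) (j : Fin 5) hij => by
      change (![0, 1, 2, 3, 4] : Fin 5 → ℕ) i = (![1, 5, 2, 3, 4] : Fin 5 → ℕ) j at hij
      fin_cases i <;> fin_cases j <;> first | rfl | cases hij

def leftStep (m : ℕ) : InclDep (gridSig m) where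
  body := leftGen 0 1 2 3 4
  head := step 0 1
  body_injective := show Function.Injective (![0, 1, 2, 3, 4] : Fin 5 → ℕ) by decide
  head_injective := show Function.Injective (![0, 1] : Fin 2 → ℕ) by decide

theorem leftStep_holds_iff [Nonempty A] {F : Set (RelFact (gridSig m) A)} :
    (leftStep m).Holds F ↔ ∀ x y z s t, leftGen x y z s t ∈ F → step x y ∈ F := by
  rw [InclDep.holds_iff]
  constructor
  · intro h x y z s t hb
    obtain ⟨w, h1, h2⟩ := h (![x, y, z, s, t] : Fin 5 → A) hb
    change ∀ (i : Fin 5) (j : Fin 2), _ → _ at h1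
    change Fin 2 → A at w
    have key : step (w 0) (w 1) ∈ F := by rw [step_eta]; exact h2
    rw [show w 0 = x from h1 0 0 rfl, show w 1 = y from h1 1 1 rfl] at key
    exact key
  · intro h v hv
    change Fin 5 → A at v
    have hb : leftGen (v 0) (v 1) (v 2) (v 3) (v 4) ∈ F := by rw [leftGen_eta]; exact hv
    have h2 := h _ _ _ _ _ hb
    refine ⟨(![v 0, v 1] : Fin 2 → A), ?_, h2⟩
    exact fun (i : Fin 5) (j : Fin 2) hij => by
      change (![0, 1, 2, 3, 4] : Fin 5 → ℕ) i = (![0, 1] : Fin 2 → ℕ) j at hij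
      fin_cases i <;> fin_cases j <;> first | rfl | cases hij

/-- S points away from the origin on both rays, whereas `next` always points to the right; hence the
swap. -/
def leftNext (m : ℕ) : InclDep (gridSig m) where
  body := leftGen 0 1 2 3 4
  head := next 1 0
  body_injective := show Function.Injective (![0, 1, 2, 3, 4] : Fin 5 → ℕ) by decide
  head_injective := show Function.Injective (![1, 0] : Fin 2 → ℕ) by decide

theorem leftNext_holds_iff [Nonempty A] {F : Set (RelFact (gridSig m) A)} :
    (leftNext m).Holds F ↔ ∀ x y z s t, leftGen x y z s t ∈ F → next y x ∈ F := by
  rw [InclDep.holds_iff]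
  constructor
  · intro h x y z s t hb
    obtain ⟨w, h1, h2⟩ := h (![x, y, z, s, t] : Fin 5 → A) hb
    change ∀ (i : Fin 5) (j : Fin 2), _ → _ at h1
    change Fin 2 → A at w
    have key : next (w 0) (w 1) ∈ F := by rw [next_eta]; exact h2
    rw [show w 0 = y from h1 1 0 rfl, show w 1 = x from h1 0 1 rfl] at key
    exact key
  · intro h v hv
    change Fin 5 → A at v
    have hb : leftGen (v 0) (v 1) (v 2) (v 3) (v 4) ∈ F := by rw [leftGen_eta]; exact hv
    have h2 := h _ _ _ _ _ hb
    refine ⟨(![v 1, v 0] : Fin 2 → A), ?_, h2⟩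
    exact fun (i : Fin 5) (j : Fin 2) hij => by
      change (![0, 1, 2, 3, 4] : Fin 5 → ℕ) i = (![1, 0] : Fin 2 → ℕ) j at hij
      fin_cases i <;> fin_cases j <;> first | rfl | cases hij

def leftLabel (m : ℕ) : InclDep (gridSig m) where
  body := leftGen 0 1 2 3 4
  head := label 2 1 3 4
  body_injective := show Function.Injective (![0, 1, 2, 3, 4] : Fin 5 → ℕ) by decide
  head_injective := show Function.Injective (![2, 1, 3, 4] : Fin 4 → ℕ) by decide

theorem leftLabel_holds_iff [Nonempty A] {F : Set (RelFact (gridSig m) A)} :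
    (leftLabel m).Holds F ↔ ∀ x y z s t, leftGen x y z s t ∈ F → label z y s t ∈ F := by
  rw [InclDep.holds_iff]
  constructor
  · intro h x y z s t hb
    obtain ⟨w, h1, h2⟩ := h (![x, y, z, s, t] : Fin 5 → A) hb
    change ∀ (i : Fin 5) (j : Fin 4), _ → _ at h1
    change Fin 4 → A at w
    have key : label (w 0) (w 1) (w 2) (w 3) ∈ F := by rw [label_eta]; exact h2
    rw [show w 0 = z from h1 2 0 rfl, show w 1 = y from h1 1 1 rfl,
      show w 2 = s from h1 3 2 rfl, show w 3 = t from h1 4 3 rfl] at key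
    exact key
  · intro h v hv
    change Fin 5 → A at v
    have hb : leftGen (v 0) (v 1) (v 2) (v 3) (v 4) ∈ F := by rw [leftGen_eta]; exact hv
    have h2 := h _ _ _ _ _ hb
    refine ⟨(![v 2, v 1, v 3, v 4] : Fin 4 → A), ?_, h2⟩
    exact fun (i : Fin 5) (j : Fin 4) hij => by
      change (![0, 1, 2, 3, 4] : Fin 5 → ℕ) i = (![2, 1, 3, 4] : Fin 4 → ℕ) j at hij
      fin_cases i <;> fin_cases j <;> first | rfl | cases hij

def leftNew (m : ℕ) : InclDep (gridSig m) where
  body := leftGen 0 1 2 3 4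
  head := leftGen 1 5 2 3 4
  body_injective := show Function.Injective (![0, 1, 2, 3, 4] : Fin 5 → ℕ) by decide
  head_injective := show Function.Injective (![1, 5, 2, 3, 4] : Fin 5 → ℕ) by decide

theorem leftNew_holds_iff [Nonempty A] {F : Set (RelFact (gridSig m) A)} :
    (leftNew m).Holds F ↔ ∀ x y z s t, leftGen x y z s t ∈ F → ∃ p, leftGen y p z s t ∈ F := by
  rw [InclDep.holds_iff]
  constructor
  · intro h x y z s t hb
    obtain ⟨w, h1, h2⟩ := h (![x, y, z, s, t] : Fin 5 → A) hb
    change ∀ (i : Fin 5) (j : Fin 5), _ → _ at h1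
    change Fin 5 → A at w
    have key : leftGen (w 0) (w 1) (w 2) (w 3) (w 4) ∈ F := by rw [leftGen_eta]; exact h2
    rw [show w 0 = y from h1 1 0 rfl, show w 2 = z from h1 2 2 rfl,
      show w 3 = s from h1 3 3 rfl, show w 4 = t from h1 4 4 rfl] at key
    exact ⟨w 1, key⟩
  · intro h v hv
    change Fin 5 → A at v
    have hb : leftGen (v 0) (v 1) (v 2) (v 3) (v 4) ∈ F := by rw [leftGen_eta]; exact hv
    obtain ⟨p, h2⟩ := h _ _ _ _ _ hb
    refine ⟨(![v 1, p, v 2, v 3, v 4] : Fin 5 → A), ?_, h2⟩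
    exact fun (i : Fin 5) (j : Fin 5) hij => by
      change (![0, 1, 2, 3, 4] : Fin 5 → ℕ) i = (![1, 5, 2, 3, 4] : Fin 5 → ℕ) j at hij
      fin_cases i <;> fin_cases j <;> first | rfl | cases hij

/-- The inclusion dependencies used in the reduction. -/
def deps (m : ℕ) : Set (InclDep (gridSig m)) :=
  {reachLabel m, labelReach m, timeStep m, timeNew m, rightStep m, rightNext m, rightLabel m, rightNew m, leftStep m, leftNext m, leftLabel m, leftNew m}

theorem deps_finite (m : ℕ) : (deps m).Finite := by simp [deps]

/-- The semantic content of the dependencies. -/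
structure Closed (F : Set (RelFact (gridSig m) A)) : Prop where
  reachLabel : ∀ x y, reach x y ∈ F → ∃ p q, label x y p q ∈ F
  labelReach : ∀ x y z s, label x y z s ∈ F → reach z s ∈ F
  timeStep : ∀ x y z, time x y z ∈ F → step x y ∈ F
  timeNew : ∀ x y z, time x y z ∈ F → ∃ p, time p x z ∈ F
  rightStep : ∀ x y z s t, rightGen x y z s t ∈ F → step x y ∈ F
  rightNext : ∀ x y z s t, rightGen x y z s t ∈ F → next x y ∈ F
  rightLabel : ∀ x y z s t, rightGen x y z s t ∈ F → label z y s t ∈ F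
  rightNew : ∀ x y z s t, rightGen x y z s t ∈ F → ∃ p, rightGen y p z s t ∈ F
  leftStep : ∀ x y z s t, leftGen x y z s t ∈ F → step x y ∈ F
  leftNext : ∀ x y z s t, leftGen x y z s t ∈ F → next y x ∈ F
  leftLabel : ∀ x y z s t, leftGen x y z s t ∈ F → label z y s t ∈ F
  leftNew : ∀ x y z s t, leftGen x y z s t ∈ F → ∃ p, leftGen y p z s t ∈ F

theorem closed_iff [Nonempty A] {F : Set (RelFact (gridSig m) A)} :
    (∀ τ ∈ deps m, τ.Holds F) ↔ Closed F := by
  simp only [deps, Set.mem_insert_iff, Set.mem_singleton_iff, forall_eq_or_imp, forall_eq,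
    reachLabel_holds_iff, labelReach_holds_iff, timeStep_holds_iff, timeNew_holds_iff, rightStep_holds_iff, rightNext_holds_iff, rightLabel_holds_iff, rightNew_holds_iff, leftStep_holds_iff, leftNext_holds_iff, leftLabel_holds_iff, leftNew_holds_iff]
  exact ⟨fun ⟨a0, a1, a2, a3, a4, a5, a6, a7, a8, a9, a10, a11⟩ => ⟨a0, a1, a2, a3, a4, a5, a6, a7, a8, a9, a10, a11⟩,
    fun ⟨a0, a1, a2, a3, a4, a5, a6, a7, a8, a9, a10, a11⟩ => ⟨a0, a1, a2, a3, a4, a5, a6, a7, a8, a9, a10, a11⟩⟩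

/-! ### The query as a disjunction of patterns simulated by flags. -/

section Query

theorem holds_rel {σ : TCSignature} {V : Type} {F : Set (RelFact σ A)} {h : V → A} {f : RelFact σ V} :
    (QAtom.rel f).Holds F h ↔ f.map h ∈ F := Iff.rfl

variable {κ : ℕ} {V : Type}

/-- The variables of a pattern: `x, x', y₋, y, y₊` and the flag, then for each of the four cells
of a pattern the end point and the path coding the label. -/
abbrev PatVar (κ : ℕ) : Type := Fin 6 ⊕ Fin 4 × Option (Fin (κ + 2))

/-- The time coordinates of the four cells of a pattern. -/
def cellTime : Fin 4 → Fin 6 := ![0, 0, 0, 1]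

/-- The space coordinates of the four cells of a pattern. -/
def cellSpace : Fin 4 → Fin 6 := ![2, 3, 4, 3]

/-- The indices up to `k` demand k + 1 edges. Without the end equation the last label no longer
fixes the length of the path. -/
def cellAtoms (e : PatVar κ → V) (k : Fin (κ + 1)) (c : Fin 4) : List (QAtom (gridSig m) V) :=
  QAtom.rel (label (e (.inl (cellTime c))) (e (.inl (cellSpace c))) (e (.inr (c, some 0)))
      (e (.inr (c, none)))) ::
    (((List.finRange (κ + 1)).filter (· ≤ k)).map fun j =>
      QAtom.rel (step (e (.inr (c, some j.castSucc))) (e (.inr (c, some j.succ))))) ++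
    if k = Fin.last κ then [] else
      [QAtom.eq (e (.inr (c, none))) (e (.inr (c, some k.succ)))]

def patAtoms (e : PatVar κ → V) (labs : Fin 4 → Fin (κ + 1)) : List (QAtom (gridSig m) V) :=
  [QAtom.rel (time (e (.inl 1)) (e (.inl 0)) (e (.inl 5))),
    QAtom.rel (next (e (.inl 2)) (e (.inl 3))), QAtom.rel (next (e (.inl 3)) (e (.inl 4)))] ++
    (List.finRange 4).flatMap fun c => cellAtoms e (labs c) c

/-- The path `p` and the end point `v` show that `(x, y)` carries the label `k`; the last label
says that the path coding the label is too long. -/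
structure LabelWitness (F : Set (RelFact (gridSig m) A)) (k : Fin (κ + 1)) (x y : A)
    (p : Fin (κ + 2) → A) (v : A) : Prop where
  label_mem : label x y (p 0) v ∈ F
  step_mem : ∀ j ≤ k, step (p j.castSucc) (p j.succ) ∈ F
  eq_end : k ≠ Fin.last κ → v = p k.succ

/-- The assignment `g` matches the pattern with the labels `labs`. -/
structure PatHolds (F : Set (RelFact (gridSig m) A)) (labs : Fin 4 → Fin (κ + 1))
    (g : PatVar κ → A) : Prop where
  time_mem : time (g (.inl 1)) (g (.inl 0)) (g (.inl 5)) ∈ F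
  left_mem : next (g (.inl 2)) (g (.inl 3)) ∈ F
  right_mem : next (g (.inl 3)) (g (.inl 4)) ∈ F
  label_mem : ∀ c, LabelWitness F (labs c) (g (.inl (cellTime c))) (g (.inl (cellSpace c)))
    (fun j => g (.inr (c, some j))) (g (.inr (c, none)))

theorem cellAtoms_holds_iff {F : Set (RelFact (gridSig m) A)} {e : PatVar κ → V}
    {k : Fin (κ + 1)} {c : Fin 4} {h : V → A} :
    (∀ α ∈ cellAtoms e k c, α.Holds F h) ↔
      LabelWitness F k (h (e (.inl (cellTime c)))) (h (e (.inl (cellSpace c))))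
        (fun j => h (e (.inr (c, some j)))) (h (e (.inr (c, none)))) := by
  have : (∀ α ∈ (if k = Fin.last κ then [] else
      [QAtom.eq (e (.inr (c, none))) (e (.inr (c, some k.succ)))] : List (QAtom (gridSig m) V)),
      α.Holds F h) ↔ (k ≠ Fin.last κ → h (e (.inr (c, none))) = h (e (.inr (c, some k.succ)))) := by
    split <;> simp_all [QAtom.Holds]
  simp only [cellAtoms, List.cons_append, List.forall_mem_cons, List.forall_mem_append, this,
    List.forall_mem_map, List.mem_filter, List.mem_finRange, true_and, decide_eq_true_eq,
    holds_rel, map_label, map_step]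
  exact ⟨fun ⟨a, b, c⟩ => ⟨a, b, c⟩, fun ⟨a, b, c⟩ => ⟨a, b, c⟩⟩

theorem patAtoms_holds_iff {F : Set (RelFact (gridSig m) A)} {e : PatVar κ → V}
    {labs : Fin 4 → Fin (κ + 1)} {h : V → A} :
    (∀ α ∈ patAtoms e labs, α.Holds F h) ↔ PatHolds F labs (h ∘ e) := by
  have : (∀ α ∈ ((List.finRange 4).flatMap fun c => cellAtoms e (labs c) c :
      List (QAtom (gridSig m) V)), α.Holds F h) ↔
      ∀ c, ∀ α ∈ (cellAtoms e (labs c) c : List (QAtom (gridSig m) V)), α.Holds F h := by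
    simp only [List.mem_flatMap, List.mem_finRange, true_and]
    exact ⟨fun H c α hα => H α ⟨c, hα⟩, fun H α ⟨c, hα⟩ => H c α hα⟩
  simp only [patAtoms, List.cons_append, List.nil_append, List.forall_mem_cons, this,
    cellAtoms_holds_iff, holds_rel, map_time, map_next]
  exact ⟨fun ⟨a, b, c, d⟩ => ⟨a, b, c, d⟩, fun ⟨a, b, c, d⟩ => ⟨a, b, c, d⟩⟩

theorem isBase_of_mem_patAtoms {e : PatVar κ → V} {labs : Fin 4 → Fin (κ + 1)}
    {α : QAtom (gridSig m) V} (h : α ∈ patAtoms e labs) : α.IsBase := by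
  simp only [patAtoms, cellAtoms, List.mem_append, List.mem_cons, List.not_mem_nil, or_false,
    List.mem_flatMap, List.mem_map] at h
  rcases h with (rfl | rfl | rfl) | ⟨c, -, (rfl | ⟨j, -, rfl⟩) | h⟩
  any_goals rfl
  split at h <;> simp at h
  subst h
  trivial

/-- The patterns use disjoint variables and interact only through their flags in the `disj` atom. -/
def queryAtoms (labs : Fin m → Fin 4 → Fin (κ + 1)) (e : Fin m × PatVar κ → V) :
    List (QAtom (gridSig m) V) :=
  QAtom.rel (disj fun i => e (i, .inl 5)) ::
    (List.finRange m).flatMap fun i => patAtoms (fun v => e (i, v)) (labs i)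

theorem queryAtoms_hold_iff {F : Set (RelFact (gridSig m) A)}
    {labs : Fin m → Fin 4 → Fin (κ + 1)} {e : Fin m × PatVar κ → V} {h : V → A} :
    (∀ α ∈ queryAtoms labs e, α.Holds F h) ↔ disj (fun i => h (e (i, .inl 5))) ∈ F ∧
      ∀ i, PatHolds F (labs i) fun v => h (e (i, v)) := by
  simp only [queryAtoms, List.forall_mem_cons, holds_rel, map_disj]
  refine and_congr_right fun _ => ⟨fun H i => patAtoms_holds_iff.1 fun α hα =>
    H α (List.mem_flatMap.2 ⟨i, List.mem_finRange _, hα⟩), fun H α hα => ?_⟩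
  obtain ⟨i, -, hα⟩ := List.mem_flatMap.1 hα
  exact patAtoms_holds_iff.2 (H i) α hα

/-- The query asking that, among the given patterns, one matches with its flag raised. -/
noncomputable def query (labs : Fin m → Fin 4 → Fin (κ + 1)) : BoolCQ (gridSig m) where
  numVars := Fintype.card (Fin m × PatVar κ)
  atoms := queryAtoms labs (Fintype.equivFin _)

theorem query_isBase (labs : Fin m → Fin 4 → Fin (κ + 1)) : (query labs).IsBase := by
  intro α hα
  change α ∈ queryAtoms labs _ at hα
  simp only [queryAtoms, List.mem_cons, List.mem_flatMap] at hα
  rcases hα with rfl | ⟨i, -, h⟩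
  · rfl
  · exact isBase_of_mem_patAtoms h

theorem query_holds_iff {labs : Fin m → Fin 4 → Fin (κ + 1)}
    {F : Set (RelFact (gridSig m) A)} :
    (query labs).Holds F ↔ ∃ g : Fin m → PatVar κ → A, (∀ i v, g i v ∈ factElems F) ∧
      disj (fun i => g i (.inl 5)) ∈ F ∧ ∀ i, PatHolds F (labs i) (g i) := by
  constructor
  · rintro ⟨h, hd, hh⟩
    obtain ⟨h1, h2⟩ := queryAtoms_hold_iff.1 hh
    exact ⟨fun i v => h (Fintype.equivFin _ (i, v)), fun i v => hd _, h1, h2⟩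
  · rintro ⟨g, hd, h1, h2⟩
    refine ⟨fun x => g ((Fintype.equivFin _).symm x).1 ((Fintype.equivFin _).symm x).2,
      fun v => hd _ _, queryAtoms_hold_iff.2 ?_⟩
    simpa using ⟨h1, h2⟩

end Query

end Grid

/-- The continuation depends on an edge rather than a vertex, so the recursion runs over edges. It
extracts the time axis and both rays from an arbitrary model. -/
theorem exists_chain {α : Type*} {R : α → α → Prop} (hR : ∀ x y, R x y → ∃ z, R y z) {a b : α}
    (hab : R a b) : ∃ s : ℕ → α, s 0 = a ∧ ∀ n, R (s n) (s (n + 1)) := by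
  choose! nxt hnxt using hR
  let st : ℕ → {p : α × α // R p.1 p.2} :=
    Nat.rec ⟨(a, b), hab⟩ fun _ p => ⟨(p.1.2, nxt p.1.1 p.1.2), hnxt _ _ p.2⟩
  exact ⟨fun n => (st n).1.1, rfl, fun n => (st n).2⟩

theorem Relation.TransGen.exists_path {α : Type*} {R : α → α → Prop} {a b : α}
    (h : Relation.TransGen R a b) :
    ∃ (n : ℕ) (q : ℕ → α), q 0 = a ∧ q (n + 1) = b ∧ ∀ j ≤ n, R (q j) (q (j + 1)) := by
  induction h with
  | @single b h => exact ⟨0, fun j => if j = 0 then a else b, by simp, by simp, by simpa using h⟩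
  | @tail b c _ h ih =>
    obtain ⟨n, q, h0, h1, hq⟩ := ih
    refine ⟨n + 1, fun j => if j ≤ n + 1 then q j else c, by simp [h0], by simp, fun j hj => ?_⟩
    obtain hj' | rfl := hj.lt_or_eq
    · simpa [hj, Nat.lt_succ_iff.1 hj', hj'] using hq j (by omega)
    · simpa [h1] using h

/-! ### The input facts, and why the query holds when a target state is reached. -/

namespace Grid

/-- The elements of the intended model: times, tape positions, a line coding the labels, and
three constants. -/
inductive Elem
  | tm (i : ℕ)
  | sp (z : ℤ)
  | line (j : ℕ)
  | dummy
  | raised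
  | lowered

open Elem

variable {m κ : ℕ}

/-- The facts of the initial row at the positions of the word. -/
def wordFacts (blank : Fin κ) (w : List (Fin κ)) (j : ℕ) : List (RelFact (gridSig m) Elem) :=
  [step (sp j) (sp (j + 1)), next (sp j) (sp (j + 1)),
    label (tm 0) (sp j) (line 0) (line (w.getD j blank + 1))]

/-- The facts that do not depend on the word. -/
def constFacts (m κ : ℕ) : List (RelFact (gridSig m) Elem) :=
  [step dummy dummy, time dummy dummy lowered, next dummy dummy, label dummy dummy dummy dummy,
    time (tm 1) (tm 0) raised, step (tm 0) (sp 0)] ++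
  ((List.range κ).map fun j => step (line j) (line (j + 1))) ++
  (List.finRange m).map fun i => disj fun i' => if i' = i then raised else lowered

/-- The facts that start the blank part of the initial row after a word of length `n`. -/
def blankFacts (blank : Fin κ) (n : ℕ) : List (RelFact (gridSig m) Elem) :=
  [label (tm 0) (sp n) (line 0) (line (blank + 1)),
    rightGen (sp n) (sp (n + 1)) (tm 0) (line 0) (line (blank + 1)),
    leftGen (sp 0) (sp (-1)) (tm 0) (line 0) (line (blank + 1))]

def initFacts (blank : Fin κ) (w : List (Fin κ)) : List (RelFact (gridSig m) Elem) :=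
  constFacts m κ ++ blankFacts blank w.length ++
    (List.range w.length).flatMap (wordFacts blank w)

section HasLabel

variable {A : Type*} {F : Set (RelFact (gridSig m) A)}

theorem mem_factElems {f : RelFact (gridSig m) A} (hf : f ∈ F) (i : Fin ((gridSig m).arity f.rel)) :
    f.args i ∈ factElems F := ⟨f, hf, i, rfl⟩

theorem step_left_mem {x y : A} (h : step x y ∈ F) : x ∈ factElems F :=
  mem_factElems h (0 : Fin 2)
theorem step_right_mem {x y : A} (h : step x y ∈ F) : y ∈ factElems F :=
  mem_factElems h (1 : Fin 2)

/-- The path must stay in the domain because the query quantifies over it. In an arbitrary model a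
pair may carry several labels. -/
def HasLabel (F : Set (RelFact (gridSig m) A)) (k : Fin (κ + 1)) (x y : A) : Prop :=
  ∃ p v, LabelWitness F k x y p v ∧ ∀ j, p j ∈ factElems F

/-- A path of n + 1 edges gives the label `n`, capped at `κ`. Past its end the path is padded with
its last point, which keeps the unused variables in the domain. -/
theorem exists_hasLabel (κ : ℕ) {x y u v : A} (h : label x y u v ∈ F)
    (huv : Relation.TransGen (fun x y => step x y ∈ F) u v) :
    ∃ k : Fin (κ + 1), HasLabel F k x y := by
  obtain ⟨n, q, rfl, rfl, hq⟩ := huv.exists_path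
  refine ⟨⟨min n κ, by omega⟩, fun j => q (min j (n + 1)), q (n + 1),
    ⟨by simpa using h, fun j hj => ?_, fun hk => ?_⟩, fun j => ?_⟩
  · have : (j : ℕ) ≤ n := (Fin.le_def.1 hj).trans (min_le_left _ _)
    simp only [Fin.val_castSucc, Fin.val_succ]
    rw [min_eq_left (by omega), min_eq_left (by omega)]
    exact hq j this
  · have : min n κ ≠ κ := fun h => hk (Fin.ext h)
    simp only [Fin.val_succ]
    congr 1
    omega
  · obtain h | h := Nat.lt_or_ge n j
    · simp only [min_eq_right (show n + 1 ≤ (j : ℕ) from h)]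
      exact step_right_mem (hq n le_rfl)
    · simp only [min_eq_left (show (j : ℕ) ≤ n + 1 by omega)]
      exact step_left_mem (hq j h)

/-- `L` labels a window `l, c, r` together with a wrong successor, or with `c` a target state. -/
def IsBad (f : Fin κ → Fin κ → Fin κ → Fin κ) (H : Set (Fin κ)) (L : Fin 4 → Fin (κ + 1)) : Prop :=
  ∃ (l c r : Fin κ) (n : Fin (κ + 1)), L = ![l.castSucc, c.castSucc, r.castSucc, n] ∧
    (c ∈ H ∨ n ≠ (f l c r).castSucc)

/-- There are finitely many label vectors, so the defects can be listed; their number `m` becomes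
the arity of the Or relation. -/
theorem exists_bad_enumeration (f : Fin κ → Fin κ → Fin κ → Fin κ) (H : Set (Fin κ)) :
    ∃ (m : ℕ) (labs : Fin m → Fin 4 → Fin (κ + 1)), ∀ L, (∃ i, labs i = L) ↔ IsBad f H L := by
  obtain ⟨m, ⟨e⟩⟩ := Finite.exists_equiv_fin {L // IsBad f H L}
  exact ⟨m, fun i => (e.symm i).1, fun L => ⟨by rintro ⟨i, rfl⟩; exact (e.symm i).2,
    fun h => ⟨e ⟨L, h⟩, by simp⟩⟩⟩

variable {ι : Elem → A} {blank : Fin κ} {w : List (Fin κ)}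
  (hF : ∀ f ∈ initFacts blank w, f.map ι ∈ F)

include hF

theorem constFacts_map_mem {f : RelFact (gridSig m) Elem} (hf : f ∈ constFacts m κ) :
    f.map ι ∈ F :=
  hF f (by simp [initFacts, hf])

theorem blankFacts_map_mem {f : RelFact (gridSig m) Elem} (hf : f ∈ blankFacts blank w.length) :
    f.map ι ∈ F :=
  hF f (by simp [initFacts, hf])

theorem wordFacts_map_mem {f : RelFact (gridSig m) Elem} {j : ℕ} (hj : j < w.length)
    (hf : f ∈ wordFacts blank w j) : f.map ι ∈ F :=
  hF f (List.mem_append_right _ (List.mem_flatMap.2 ⟨j, List.mem_range.2 hj, hf⟩))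

theorem dummy_step : step (ι dummy) (ι dummy) ∈ F := by
  simpa only [map_step] using constFacts_map_mem hF (f := step dummy dummy) (by simp [constFacts])

theorem line_step {j : ℕ} (hj : j < κ) : step (ι (line j)) (ι (line (j + 1))) ∈ F := by
  simpa only [map_step] using constFacts_map_mem hF (f := step (line j) (line (j + 1)))
    (by simp only [constFacts, List.mem_append, List.mem_map, List.mem_range]
        exact .inl (.inr ⟨j, hj, rfl⟩))

theorem line_mem_factElems {j : ℕ} (hj : j ≤ κ) (hκ : 0 < κ) : ι (line j) ∈ factElems F := by
  obtain _ | j := j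
  · exact step_left_mem (line_step hF hκ)
  · exact step_right_mem (line_step hF hj)

theorem hasLabel_of_line {k : Fin κ} {x y : A}
    (h : label x y (ι (line 0)) (ι (line (k + 1))) ∈ F) : HasLabel F k.castSucc x y := by
  have hk := k.2
  refine ⟨fun j => ι (line (min j κ)), _, ⟨by simpa using h, fun j hj => ?_, fun _ => ?_⟩,
    fun j => line_mem_factElems hF (min_le_right _ _) (by omega)⟩
  · have : (j : ℕ) ≤ k := Fin.le_def.1 hj
    simp only [Fin.val_castSucc, Fin.val_succ]
    rw [min_eq_left (by omega), min_eq_left (by omega)]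
    exact line_step hF (by omega)
  · simp only [Fin.val_castSucc, Fin.val_succ]
    rw [min_eq_left (by omega)]

/-- The S-loop at `dummy` is a path of every length with the same ends, so `dummy` carries all
labels at once. -/
theorem dummy_patHolds (L : Fin 4 → Fin (κ + 1)) :
    PatHolds F L fun v => if v = .inl 5 then ι lowered else ι dummy where
  time_mem := by
    have h := constFacts_map_mem hF (f := time dummy dummy lowered) (by simp [constFacts])
    rw [map_time] at h
    exact h
  left_mem := by
    have h := constFacts_map_mem hF (f := next dummy dummy) (by simp [constFacts])
    rw [map_next] at h
    exact h
  right_mem := by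
    have h := constFacts_map_mem hF (f := next dummy dummy) (by simp [constFacts])
    rw [map_next] at h
    exact h
  label_mem c := by
    have h1 : ∀ c, cellTime c ≠ 5 := by decide
    have h2 : ∀ c, cellSpace c ≠ 5 := by decide
    simp only [Sum.inl.injEq, h1, h2, if_false, reduceCtorEq]
    have h3 := constFacts_map_mem hF (f := label dummy dummy dummy dummy) (by simp [constFacts])
    rw [map_label] at h3
    exact ⟨h3, fun _ _ => dummy_step hF, fun _ => rfl⟩

/-- One genuine match is enough: all other patterns are sent to `dummy`, and the initial Or fact
raising only the flag `i` matches. -/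
theorem query_holds_of_patHolds {labs : Fin m → Fin 4 → Fin (κ + 1)} {i : Fin m}
    {g : PatVar κ → A} (hg : PatHolds F (labs i) g) (hraised : g (.inl 5) = ι raised)
    (hdom : ∀ v, g v ∈ factElems F) : (query labs).Holds F := by
  refine query_holds_iff.2 ⟨fun i' v => if i' = i then g v else
    if v = .inl 5 then ι lowered else ι dummy, fun i' v => ?_, ?_, fun i' => ?_⟩
  · dsimp only
    split_ifs
    · exact hdom v
    · exact mem_factElems (dummy_patHolds hF (labs i)).time_mem (2 : Fin 3)
    · exact step_left_mem (dummy_step hF)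
  · have := constFacts_map_mem hF (f := disj fun i' => if i' = i then raised else lowered)
      (by simp only [constFacts, List.mem_append, List.mem_map, List.mem_finRange, true_and]
          exact .inr ⟨i, rfl⟩)
    rw [map_disj] at this
    convert this using 3 with i'
    simp only [if_true, hraised, Function.comp_apply]
    split_ifs <;> rfl
  · by_cases hi : i' = i
    · subst hi
      simpa using hg
    · simpa [hi] using dummy_patHolds hF (labs i')

theorem query_holds_of_isBad {labs : Fin m → Fin 4 → Fin (κ + 1)} {i : Fin m}
    {x x' y₀ y₁ y₂ : A} (ht : time x' x (ι raised) ∈ F) (h0 : next y₀ y₁ ∈ F) (h1 : next y₁ y₂ ∈ F)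
    (hl : HasLabel F (labs i 0) x y₀) (hc : HasLabel F (labs i 1) x y₁)
    (hr : HasLabel F (labs i 2) x y₂) (hn : HasLabel F (labs i 3) x' y₁) :
    (query labs).Holds F := by
  let X : Fin 6 → A := ![x, x', y₀, y₁, y₂, ι raised]
  have hlab : ∀ c, HasLabel F (labs i c) (X (cellTime c)) (X (cellSpace c)) := by
    intro c
    fin_cases c <;> assumption
  choose p v hpv hp using hlab
  refine query_holds_of_patHolds hF (i := i)
    (g := Sum.elim X fun c => c.2.elim (v c.1) (p c.1)) ⟨ht, h0, h1, hpv⟩ rfl ?_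
  rintro (j | ⟨c, _ | j⟩)
  · change X j ∈ _
    fin_cases j
    · exact mem_factElems ht (1 : Fin 3)
    · exact mem_factElems ht (0 : Fin 3)
    · exact mem_factElems h0 (0 : Fin 2)
    · exact mem_factElems h0 (1 : Fin 2)
    · exact mem_factElems h1 (1 : Fin 2)
    · exact mem_factElems ht (2 : Fin 3)
  · exact mem_factElems (hpv c).label_mem (3 : Fin 4)
  · exact hp c j

/-- Every model contains a grid whose first row is labelled by the initial word. -/
theorem exists_grid (hcl : Closed F) (htc : RespectsTC F) :
    ∃ (T : ℕ → A) (Y : ℤ → A), (∀ i, time (T (i + 1)) (T i) (ι raised) ∈ F) ∧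
      (∀ z, next (Y z) (Y (z + 1)) ∈ F) ∧ (∀ i z, reach (T i) (Y z) ∈ F) ∧
      ∀ z, HasLabel F (wordRow blank w z).castSucc (T 0) (Y z) := by
  have hread := fun (a b : A) => (respectsTC_iff.1 htc a b).2
  have hT1 := constFacts_map_mem hF (f := time (tm 1) (tm 0) raised) (by simp [constFacts])
  have hroot := constFacts_map_mem hF (f := step (tm 0) (sp 0)) (by simp [constFacts])
  have hlab := blankFacts_map_mem hF
    (f := label (tm 0) (sp w.length) (line 0) (line (blank + 1))) (by simp [blankFacts])
  have hright := blankFacts_map_mem hF (f := rightGen (sp w.length) (sp (w.length + 1)) (tm 0)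
    (line 0) (line (blank + 1))) (by simp [blankFacts])
  have hleft := blankFacts_map_mem hF (f := leftGen (sp 0) (sp (-1)) (tm 0)
    (line 0) (line (blank + 1))) (by simp [blankFacts])
  rw [map_time] at hT1
  rw [map_step] at hroot
  rw [map_label] at hlab
  rw [map_rightGen] at hright
  rw [map_leftGen] at hleft
  -- The relation is reversed because new instants are added in front.
  obtain ⟨T, hT0, hT⟩ := exists_chain (R := fun x y => time y x (ι raised) ∈ F)
    (fun x y h => hcl.timeNew _ _ _ h) hT1
  obtain ⟨r, hr0, hr⟩ := exists_chain (fun x y h => hcl.rightNew x y _ _ _ h) hright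
  obtain ⟨l, hl0, hl⟩ := exists_chain (fun x y h => hcl.leftNew x y _ _ _ h) hleft
  -- The right ray starts at position `w.length`, and the left ray at position 0, which is `l 0`;
  -- hence the shift in `l (j + 1)`.
  let Y : ℤ → A
    | .ofNat j => if j < w.length then ι (sp j) else r (j - w.length)
    | .negSucc j => l (j + 1)
  have hYw : ∀ j : ℕ, j ≤ w.length → Y j = ι (sp j) := by
    intro j hj
    change (if j < w.length then ι (sp j) else r (j - w.length)) = _
    split_ifs with h
    · rfl
    · obtain rfl : j = w.length := by omega
      rw [Nat.sub_self, hr0]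
  have hYr : ∀ j : ℕ, Y (w.length + j : ℕ) = r j := by
    intro j
    change (if w.length + j < w.length then _ else r (w.length + j - w.length)) = _
    rw [if_neg (by omega), Nat.add_sub_cancel_left]
  have hYl : ∀ j : ℕ, Y (-j) = l j := by
    rintro (_ | j)
    · rw [Nat.cast_zero, neg_zero, hl0]
      exact hYw 0 (Nat.zero_le _)
    · rfl
  have hstep : ∀ j : ℕ, step (Y j) (Y (j + 1)) ∈ F ∧ next (Y j) (Y (j + 1)) ∈ F := by
    intro j
    obtain hj | hj := Nat.lt_or_ge j w.length
    · have h1 := wordFacts_map_mem hF hj (f := step (sp j) (sp (j + 1))) (by simp [wordFacts])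
      have h2 := wordFacts_map_mem hF hj (f := next (sp j) (sp (j + 1))) (by simp [wordFacts])
      rw [map_step] at h1
      rw [map_next] at h2
      rw [hYw j hj.le, ← Nat.cast_succ, hYw _ hj]
      exact ⟨h1, h2⟩
    · obtain ⟨k, rfl⟩ := Nat.exists_eq_add_of_le hj
      rw [show ((w.length + k : ℕ) : ℤ) + 1 = (w.length + (k + 1) : ℕ) by push_cast; ring, hYr, hYr]
      exact ⟨hcl.rightStep _ _ _ _ _ (hr k), hcl.rightNext _ _ _ _ _ (hr k)⟩
  have hreachY : ∀ z, Relation.ReflTransGen (fun x y => step x y ∈ F) (Y 0) (Y z) := by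
    intro z
    obtain ⟨j, rfl | rfl⟩ := z.eq_nat_or_neg
    · induction j with
      | zero => exact .refl
      | succ j ih => exact ih.tail (hstep j).1
    · induction j with
      | zero => exact .refl
      | succ j ih =>
        rw [hYl] at ih ⊢
        exact ih.tail (hcl.leftStep _ _ _ _ _ (hl j))
  have hreachT : ∀ i, Relation.ReflTransGen (fun x y => step x y ∈ F) (T i) (T 0) := by
    intro i
    induction i with
    | zero => exact .refl
    | succ i ih => exact .head (hcl.timeStep _ _ _ (hT i)) ih
  have hroot' : step (T 0) (Y 0) ∈ F := by
    rw [hT0, show Y 0 = ι (sp 0) from hYw 0 (Nat.zero_le _)]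
    exact hroot
  refine ⟨T, Y, hT, fun z => ?_, fun i z => ?_, fun z => ?_⟩
  · obtain j | j := z
    · exact (hstep j).2
    · rw [show Int.negSucc j = -((j + 1 : ℕ) : ℤ) from rfl,
        show -((j + 1 : ℕ) : ℤ) + 1 = -(j : ℤ) by push_cast; ring, hYl, hYl]
      exact hcl.leftNext _ _ _ _ _ (hl j)
  -- The S-path runs down to the origin of time, across the root edge, and out along a ray.
  · exact hread _ _ ((Relation.TransGen.tail' (hreachT i) hroot').trans_left (hreachY z))
  · rw [hT0]
    refine hasLabel_of_line hF ?_
    obtain j | j := z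
    · obtain hj | hj := Nat.lt_or_ge j w.length
      · have h := wordFacts_map_mem hF hj (f := label (tm 0) (sp j) (line 0)
          (line (w.getD j blank + 1))) (by simp [wordFacts])
        rw [map_label] at h
        rw [show Y (Int.ofNat j) = _ from hYw j hj.le]
        exact h
      · rw [show wordRow blank w (Int.ofNat j) = blank from List.getD_eq_default _ _ hj]
        obtain ⟨k, rfl⟩ := Nat.exists_eq_add_of_le hj
        rw [show Y (Int.ofNat (w.length + k)) = _ from hYr k]
        obtain _ | k := k
        -- The start of the right ray is not covered by `rightLabel`; its label is an input fact.
        · rw [hr0]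
          exact hlab
        · exact hcl.rightLabel _ _ _ _ _ (hr k)
    · exact hcl.leftLabel _ _ _ _ _ (hl j)

/-- If the query fails, correct labels propagate from row to row: each cell of the next row has some
label, and any label but the value of `f`, including the overlong one, would complete a bad pattern.
The target state then appears and is bad as well. -/
theorem query_holds_of_halts (hcl : Closed F) (htc : RespectsTC F)
    {f : Fin κ → Fin κ → Fin κ → Fin κ} {H : Set (Fin κ)} {labs : Fin m → Fin 4 → Fin (κ + 1)}
    (hlabs : ∀ L, (∃ i, labs i = L) ↔ IsBad f H L)
    (hH : ∃ i z, caRun f (wordRow blank w) i z ∈ H) : (query labs).Holds F := by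
  by_contra hno
  obtain ⟨T, Y, hT, hY, hTY, h0⟩ := exists_grid hF hcl htc
  have hlabel : ∀ i z, ∃ k : Fin (κ + 1), HasLabel F k (T i) (Y z) := by
    intro i z
    obtain ⟨u, v, h⟩ := hcl.reachLabel _ _ (hTY i z)
    exact exists_hasLabel κ h ((respectsTC_iff.1 htc _ _).1 (hcl.labelReach _ _ _ _ h))
  have fire : ∀ {i z} {l c r : Fin κ} {n : Fin (κ + 1)}, HasLabel F l.castSucc (T i) (Y (z - 1)) →
      HasLabel F c.castSucc (T i) (Y z) → HasLabel F r.castSucc (T i) (Y (z + 1)) →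
      HasLabel F n (T (i + 1)) (Y z) → ¬ (c ∈ H ∨ n ≠ (f l c r).castSucc) := by
    intro i z l c r n hl hc hr hn hbad
    obtain ⟨j, hj⟩ := (hlabs _).2 ⟨l, c, r, n, rfl, hbad⟩
    have hYz := hY (z - 1)
    rw [sub_add_cancel] at hYz
    exact hno (query_holds_of_isBad hF (hT i) hYz (hY z) (i := j) (hj ▸ hl) (hj ▸ hc)
      (hj ▸ hr) (hj ▸ hn))
  have hrow : ∀ i z, HasLabel F (caRun f (wordRow blank w) i z).castSucc (T i) (Y z) := by
    intro i
    induction i with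
    | zero => exact h0
    | succ i ih =>
      intro z
      obtain ⟨n, hn⟩ := hlabel (i + 1) z
      have := fire (ih (z - 1)) (ih z) (ih (z + 1)) hn
      push Not at this
      rw [caRun, ← this.2]
      exact hn
  obtain ⟨i, z, hz⟩ := hH
  -- A pattern always includes a successor cell; for a target state any label there will do.
  obtain ⟨n, hn⟩ := hlabel (i + 1) z
  exact fire (hrow i (z - 1)) (hrow i z) (hrow i (z + 1)) hn (.inl hz)

end HasLabel

end Grid

/-! ### The countermodel when no target state is reached. -/

namespace Grid

open Elem

variable {m κ : ℕ}

inductive ElemStep (κ : ℕ) : Elem → Elem → Prop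
  | tm (i : ℕ) : ElemStep κ (tm (i + 1)) (tm i)
  | root : ElemStep κ (tm 0) (sp 0)
  | right (j : ℕ) : ElemStep κ (sp j) (sp (j + 1))
  | left (j : ℕ) : ElemStep κ (sp (-j)) (sp (-j - 1))
  | line (j : ℕ) (h : j < κ) : ElemStep κ (line j) (line (j + 1))
  | dummy : ElemStep κ dummy dummy

inductive ElemTime : Elem → Elem → Elem → Prop
  | tm (i : ℕ) : ElemTime (tm (i + 1)) (tm i) raised
  | dummy : ElemTime dummy dummy lowered

inductive ElemNext : Elem → Elem → Prop
  | sp (z : ℤ) : ElemNext (sp z) (sp (z + 1))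
  | dummy : ElemNext dummy dummy

inductive ElemRightGen (blank n : ℕ) : Elem → Elem → Elem → Elem → Elem → Prop
  | sp (j : ℕ) (hj : n ≤ j) :
    ElemRightGen blank n (sp j) (sp (j + 1)) (tm 0) (line 0) (line (blank + 1))

inductive ElemLeftGen (blank : ℕ) : Elem → Elem → Elem → Elem → Elem → Prop
  | sp (j : ℕ) : ElemLeftGen blank (sp (-j)) (sp (-j - 1)) (tm 0) (line 0) (line (blank + 1))

/-- Grid cells are labelled by the space-time diagram `c`, all other pairs by themselves. -/
inductive ElemLabel (c : ℕ → ℤ → Fin κ) : Elem → Elem → Elem → Elem → Prop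
  | cell (i : ℕ) (z : ℤ) : ElemLabel c (tm i) (sp z) (line 0) (line (c i z + 1))
  | other (x y : Elem) (h : Relation.TransGen (ElemStep κ) x y)
    (h' : ∀ i z, x = tm i → y ≠ sp z) : ElemLabel c x y x y

/-- The relations of the intended model. -/
def modelRel (m : ℕ) (blank : Fin κ) (n : ℕ) (c : ℕ → ℤ → Fin κ) :
    (r : (gridSig m).Rel) → (Fin ((gridSig m).arity r) → Elem) → Prop
  | .inl ⟨0, _⟩, v => ElemStep κ (v (0 : Fin 2)) (v (1 : Fin 2))
  | .inl ⟨1, _⟩, v => ElemTime (v (0 : Fin 3)) (v (1 : Fin 3)) (v (2 : Fin 3))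
  | .inl ⟨2, _⟩, v => ElemRightGen blank n (v (0 : Fin 5)) (v (1 : Fin 5)) (v (2 : Fin 5))
      (v (3 : Fin 5)) (v (4 : Fin 5))
  | .inl ⟨3, _⟩, v => ElemLeftGen blank (v (0 : Fin 5)) (v (1 : Fin 5)) (v (2 : Fin 5))
      (v (3 : Fin 5)) (v (4 : Fin 5))
  | .inl ⟨4, _⟩, v => ElemNext (v (0 : Fin 2)) (v (1 : Fin 2))
  | .inl ⟨5, _⟩, v => ElemLabel c (v (0 : Fin 4)) (v (1 : Fin 4)) (v (2 : Fin 4)) (v (3 : Fin 4))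
  | .inl ⟨_ + 6, _⟩, v => ∃ i, v i = raised
  | .inr _, v => Relation.TransGen (ElemStep κ) (v (0 : Fin 2)) (v (1 : Fin 2))

def model (m : ℕ) (blank : Fin κ) (n : ℕ) (c : ℕ → ℤ → Fin κ) : Set (RelFact (gridSig m) Elem) :=
  {f | modelRel m blank n c f.rel f.args}

variable {blank : Fin κ} {n : ℕ} {c : ℕ → ℤ → Fin κ}

theorem step_mem_model {x y : Elem} : step x y ∈ model m blank n c ↔ ElemStep κ x y := Iff.rfl
theorem time_mem_model {x y z : Elem} : time x y z ∈ model m blank n c ↔ ElemTime x y z := Iff.rfl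
theorem rightGen_mem_model {x y z s t : Elem} :
    rightGen x y z s t ∈ model m blank n c ↔ ElemRightGen blank n x y z s t := Iff.rfl
theorem leftGen_mem_model {x y z s t : Elem} :
    leftGen x y z s t ∈ model m blank n c ↔ ElemLeftGen blank x y z s t := Iff.rfl
theorem next_mem_model {x y : Elem} : next x y ∈ model m blank n c ↔ ElemNext x y := Iff.rfl
theorem label_mem_model {x y z s : Elem} :
    label x y z s ∈ model m blank n c ↔ ElemLabel c x y z s := Iff.rfl
theorem disj_mem_model {v : Fin m → Elem} :
    disj v ∈ model m blank n c ↔ ∃ i, v i = raised := Iff.rfl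
theorem reach_mem_model {x y : Elem} :
    reach x y ∈ model m blank n c ↔ Relation.TransGen (ElemStep κ) x y := Iff.rfl

theorem respectsTC_model : RespectsTC (model m blank n c) :=
  respectsTC_iff.2 fun _ _ => Iff.rfl

theorem transGen_line {k : ℕ} (hk : k < κ) :
    Relation.TransGen (ElemStep κ) (line 0) (line (k + 1)) := by
  induction k with
  | zero => exact .single (.line 0 hk)
  | succ k ih => exact (ih (by omega)).tail (.line _ hk)

/-- The rays label the end points of their edges, which explains the positions `j + 1` and `-j - 1`
in the hypotheses. All labels are S⁺ pairs: a line segment for a grid cell, the pair itself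
otherwise. -/
theorem closed_model (hright : ∀ j : ℕ, n ≤ j → c 0 (j + 1) = blank)
    (hleft : ∀ j : ℕ, c 0 (-j - 1) = blank) : Closed (model m blank n c) where
  reachLabel x y h := by
    by_cases hxy : ∃ i z, x = tm i ∧ y = sp z
    · obtain ⟨i, z, rfl, rfl⟩ := hxy
      exact ⟨_, _, label_mem_model.2 (.cell i z)⟩
    · exact ⟨_, _, label_mem_model.2 (.other x y h fun i z hx hy => hxy ⟨i, z, hx, hy⟩)⟩
  labelReach x y z s h := by
    rw [reach_mem_model]
    obtain ⟨i, z⟩ | ⟨_, _, h', -⟩ := label_mem_model.1 h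
    · exact transGen_line (c i z).2
    · exact h'
  timeStep x y z h := by
    obtain i | _ := time_mem_model.1 h
    · exact .tm i
    · exact .dummy
  timeNew x y z h := by
    obtain i | _ := time_mem_model.1 h
    · exact ⟨_, time_mem_model.2 (.tm (i + 1))⟩
    · exact ⟨_, time_mem_model.2 .dummy⟩
  rightStep x y z s t h := by
    obtain ⟨j, hj⟩ := rightGen_mem_model.1 h
    exact .right j
  rightNext x y z s t h := by
    obtain ⟨j, hj⟩ := rightGen_mem_model.1 h
    exact .sp j
  rightLabel x y z s t h := by
    obtain ⟨j, hj⟩ := rightGen_mem_model.1 h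
    rw [label_mem_model, ← hright j hj]
    exact .cell _ _
  rightNew x y z s t h := by
    obtain ⟨j, hj⟩ := rightGen_mem_model.1 h
    exact ⟨_, rightGen_mem_model.2 (.sp (j + 1) (by omega))⟩
  leftStep x y z s t h := by
    obtain ⟨j⟩ := leftGen_mem_model.1 h
    exact .left j
  leftNext x y z s t h := by
    obtain ⟨j⟩ := leftGen_mem_model.1 h
    have := ElemNext.sp (-j - 1)
    rw [sub_add_cancel] at this
    exact this
  leftLabel x y z s t h := by
    obtain ⟨j⟩ := leftGen_mem_model.1 h
    rw [label_mem_model, ← hleft j]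
    exact .cell _ _
  leftNew x y z s t h := by
    obtain ⟨j⟩ := leftGen_mem_model.1 h
    have := ElemLeftGen.sp (blank := blank) (j + 1)
    rw [show (-((j + 1 : ℕ) : ℤ)) = -(j : ℤ) - 1 by push_cast; ring] at this
    exact ⟨_, leftGen_mem_model.2 this⟩

theorem initFacts_subset_model {w : List (Fin κ)} (h0 : c 0 = wordRow blank w)
    {f : RelFact (gridSig m) Elem} (hf : f ∈ initFacts blank w) :
    f ∈ model m blank w.length c := by
  simp only [initFacts, constFacts, blankFacts, wordFacts, List.mem_append, List.mem_cons,
    List.not_mem_nil, or_false, List.mem_map, List.mem_flatMap, List.mem_range] at hf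
  rcases hf with (((((rfl | rfl | rfl | rfl | rfl | rfl) | ⟨j, hj, rfl⟩) | ⟨i, -, rfl⟩) |
    (rfl | rfl | rfl)) | ⟨j, hj, (rfl | rfl | rfl)⟩)
  · exact .dummy
  · exact .dummy
  · exact .dummy
  · exact .other _ _ (.single .dummy) (by rintro _ _ ⟨⟩)
  · exact .tm 0
  · exact .root
  · exact .line j hj
  · exact disj_mem_model.2 ⟨i, if_pos rfl⟩
  · have : c 0 (w.length : ℕ) = blank := by
      rw [h0]; exact List.getD_eq_default _ _ le_rfl
    rw [label_mem_model, ← this]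
    exact .cell _ _
  · exact .sp _ le_rfl
  · exact .sp 0
  · exact .right j
  · exact .sp j
  · rw [label_mem_model, show w.getD j blank = c 0 j by rw [h0]; rfl]
    exact .cell _ _

/-- Each point of the line has at most one S-successor, so the path is forced to follow the line and
its end point reveals the state. The overlong label would need an edge out of `line κ`. -/
theorem labelWitness_model {k : Fin (κ + 1)} {i : ℕ} {z : ℤ} {p : Fin (κ + 2) → Elem} {v : Elem}
    (h : LabelWitness (model m blank n c) k (tm i) (sp z) p v) : k = (c i z).castSucc := by
  have h0 : p 0 = line 0 ∧ v = line (c i z + 1) := by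
    generalize hx : p 0 = x
    have := label_mem_model.1 h.label_mem
    rw [hx] at this
    generalize ha : tm i = a at this
    generalize hb : sp z = b at this
    cases this with
    | cell i z => cases ha; cases hb; exact ⟨rfl, rfl⟩
    | other _ _ _ h' => exact (h' _ _ ha.symm hb.symm).elim
  have hp : ∀ j : ℕ, ∀ hj : j ≤ k + 1, p ⟨j, by omega⟩ = line j := by
    intro j
    induction j with
    | zero => exact fun _ => h0.1
    | succ j ih =>
      intro hj
      have hs := step_mem_model.1 (h.step_mem ⟨j, by omega⟩ (Fin.le_def.2 (by simpa using hj)))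
      have hj' : p (Fin.castSucc ⟨j, by omega⟩) = line j := ih (by omega)
      rw [hj'] at hs
      change ElemStep κ _ (p ⟨j + 1, _⟩) at hs
      generalize p ⟨j + 1, by omega⟩ = y at hs
      cases hs
      rfl
  by_cases hk : k = Fin.last κ
  · subst hk
    have hs := step_mem_model.1 (h.step_mem _ le_rfl)
    have hj' : p (Fin.castSucc (Fin.last κ)) = line κ := hp κ (by simp)
    rw [hj'] at hs
    generalize p _ = y at hs
    cases hs
    omega
  · have := (h.eq_end hk).symm.trans h0.2
    have h2 : p k.succ = line (k + 1) := hp (k + 1) le_rfl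
    rw [h2] at this
    have h3 : (k : ℕ) + 1 = c i z + 1 := by simpa using this
    exact Fin.ext (by simpa using h3)

theorem not_transGen_dummy {i : ℕ} : ¬ Relation.TransGen (ElemStep κ) (tm i) dummy := by
  have : ∀ x y, Relation.TransGen (ElemStep κ) x y → y = dummy → x = dummy := by
    intro x y h
    induction h with
    | single h => rintro rfl; cases h; rfl
    | tail _ h ih => rintro rfl; cases h; exact ih rfl
  exact fun h => Elem.noConfusion (this _ _ h rfl)

/-- A raised flag forces the time atom of its pattern to be genuine. The positions are then genuine
too, since no time reaches `dummy`, and the labels read off agree with the diagram, which has no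
defect. -/
theorem not_query_holds_model {f : Fin κ → Fin κ → Fin κ → Fin κ} {H : Set (Fin κ)}
    {labs : Fin m → Fin 4 → Fin (κ + 1)} (hlabs : ∀ i, IsBad f H (labs i))
    (hc : ∀ i z, c (i + 1) z = f (c i (z - 1)) (c i z) (c i (z + 1)))
    (hH : ∀ i z, c i z ∉ H) : ¬ (query labs).Holds (model m blank n c) := by
  rw [query_holds_iff]
  rintro ⟨g, -, hdisj, hg⟩
  obtain ⟨i, hi⟩ := disj_mem_model.1 hdisj
  obtain ⟨ht, hl, hr, hlab⟩ := hg i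
  generalize g i = a at hi ht hl hr hlab
  obtain ⟨l, cc, r, k, hL, hbad⟩ := hlabs i
  have e0 := hlab 0
  have e1 := hlab 1
  have e2 := hlab 2
  have e3 := hlab 3
  rw [hL] at e0 e1 e2 e3
  simp only [cellTime, cellSpace, Matrix.cons_val] at e0 e1 e2 e3
  rw [time_mem_model, hi] at ht
  rw [next_mem_model] at hl hr
  generalize a (.inl 0) = x at *
  generalize a (.inl 1) = x' at *
  generalize a (.inl 2) = y₀ at *
  generalize a (.inl 3) = y₁ at *
  generalize a (.inl 4) = y₂ at *
  obtain ⟨t⟩ := ht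
  cases hl with
  | dummy =>
    have := label_mem_model.1 e1.label_mem
    generalize a (.inr (1, some 0)) = p at this
    generalize a (.inr (1, none)) = v at this
    cases this with
    | other _ _ h _ => exact not_transGen_dummy h
  | sp z =>
    cases hr
    have e0 := labelWitness_model e0
    have e1 := labelWitness_model e1
    have e2 := labelWitness_model e2
    have e3 := labelWitness_model e3
    simp only [Fin.castSucc_inj] at e0 e1 e2
    subst e0 e1 e2 e3
    rcases hbad with h | h
    · exact hH _ _ h
    · apply h
      rw [hc, add_sub_cancel_right]

end Grid

/-! ### Computability of the reduction and the final equivalence. -/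

namespace RelFact

theorem primrec_mk {α : Type*} [Primcodable α] {σ : TCSignature} (r : σ.Rel)
    {v : α → Fin (σ.arity r) → ℕ} (hv : ∀ i, Primrec fun a => v a i) :
    Primrec fun a => (⟨r, v a⟩ : RelFact σ ℕ) := by
  let _ : Primcodable {p : σ.Rel × List ℕ // p.2.length = σ.arity p.1} :=
    Primcodable.subtype (primrecPred_length_eq_arity σ ℕ)
  refine (Primrec.of_equiv_iff (equivList σ ℕ)).1 ?_
  refine (Primrec.subtype_val_iff (hp := primrecPred_length_eq_arity σ ℕ)).1 ?_
  exact Primrec.pair (Primrec.const r) (Primrec.list_ofFn hv)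

end RelFact

namespace Grid

open Elem

variable {m κ : ℕ}

/-- Residues modulo 4 separate times and the two kinds of positions; the residue 3 holds the
constants and, from 15 on, the line. Each family is affine in its index, which keeps the input facts
primitive recursive. -/
def Elem.code : Elem → ℕ
  | tm i => 4 * i
  | sp (.ofNat j) => 4 * j + 1
  | sp (.negSucc j) => 4 * j + 2
  | dummy => 3
  | raised => 7
  | lowered => 11
  | line j => 4 * j + 15

theorem Elem.code_bijective : Function.Bijective Elem.code := by
  constructor
  · rintro (i | (j | j) | j | _ | _ | _) (i' | (j' | j') | j' | _ | _ | _) h <;>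
      simp only [Elem.code] at h <;> first | rfl | omega | (congr 2; omega)
  · intro n
    obtain h | h | h | h : n % 4 = 0 ∨ n % 4 = 1 ∨ n % 4 = 2 ∨ n % 4 = 3 := by omega
    · exact ⟨tm (n / 4), by simp only [Elem.code]; omega⟩
    · exact ⟨sp (.ofNat (n / 4)), by simp only [Elem.code]; omega⟩
    · exact ⟨sp (.negSucc (n / 4)), by simp only [Elem.code]; omega⟩
    · obtain h' | h' | h' | h' : n = 3 ∨ n = 7 ∨ n = 11 ∨ 15 ≤ n := by omega
      · exact ⟨dummy, h'.symm⟩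
      · exact ⟨raised, h'.symm⟩
      · exact ⟨lowered, h'.symm⟩
      · exact ⟨line ((n - 15) / 4), by simp only [Elem.code]; omega⟩

/-- The input facts, with the elements named by natural numbers. -/
def codedFacts (m : ℕ) (blank : Fin κ) (w : List (Fin κ)) : List (RelFact (gridSig m) ℕ) :=
  (initFacts blank w).map (RelFact.map Elem.code)

theorem primrec_codedFacts (m : ℕ) (blank : Fin κ) :
    Primrec (codedFacts m blank) := by
  have hlen : Primrec fun w : List (Fin κ) => w.length := Primrec.list_length
  have lin : ∀ {α : Type} [Primcodable α] {f : α → ℕ} (k : ℕ), Primrec f →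
      Primrec fun a => 4 * f a + k := fun k hf =>
    Primrec.nat_add.comp (Primrec.nat_mul.comp (Primrec.const 4) hf) (Primrec.const k)
  have hblank : Primrec fun w : List (Fin κ) =>
      (blankFacts blank w.length).map (RelFact.map (σ := gridSig m) Elem.code) := by
    have e : ∀ w : List (Fin κ), (blankFacts blank w.length).map
        (RelFact.map (σ := gridSig m) Elem.code) =
        [label (4 * 0) (4 * w.length + 1) (4 * 0 + 15) (4 * (blank + 1) + 15),
          rightGen (4 * w.length + 1) (4 * (w.length + 1) + 1) (4 * 0) (4 * 0 + 15)
            (4 * (blank + 1) + 15),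
          (leftGen (sp 0) (sp (-1)) (tm 0) (line 0) (line (blank + 1))).map Elem.code] := by
      intro w
      simp only [blankFacts, List.map_cons, List.map_nil, map_label, map_rightGen]
      rfl
    refine Primrec.of_eq ?_ fun w => (e w).symm
    refine Primrec.list_cons.comp (RelFact.primrec_mk _ fun (i : Fin 4) => ?_)
      (Primrec.list_cons.comp (RelFact.primrec_mk _ fun (i : Fin 5) => ?_) (Primrec.const _))
    · fin_cases i
      · exact Primrec.const _
      · exact lin 1 hlen
      · exact Primrec.const _
      · exact Primrec.const _
    · fin_cases i
      · exact lin 1 hlen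
      · exact lin 1 (Primrec.succ.comp hlen)
      · exact Primrec.const _
      · exact Primrec.const _
      · exact Primrec.const _
  have hword : Primrec₂ fun (w : List (Fin κ)) (j : ℕ) =>
      (wordFacts blank w j).map (RelFact.map (σ := gridSig m) Elem.code) := by
    have e : ∀ (w : List (Fin κ)) (j : ℕ), (wordFacts blank w j).map
        (RelFact.map (σ := gridSig m) Elem.code) =
        [step (4 * j + 1) (4 * (j + 1) + 1), next (4 * j + 1) (4 * (j + 1) + 1),
          label (4 * 0) (4 * j + 1) (4 * 0 + 15) (4 * (w.getD j blank + 1) + 15)] := by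
      intro w j
      simp only [wordFacts, List.map_cons, List.map_nil, map_label, map_step, map_next]
      rfl
    refine Primrec.of_eq (α := List (Fin κ) × ℕ) ?_ fun p => (e p.1 p.2).symm
    have hj : Primrec fun p : List (Fin κ) × ℕ => p.2 := Primrec.snd
    refine Primrec.list_cons.comp (RelFact.primrec_mk _ fun (i : Fin 2) => ?_)
      (Primrec.list_cons.comp (RelFact.primrec_mk _ fun (i : Fin 2) => ?_)
      (Primrec.list_cons.comp (RelFact.primrec_mk _ fun (i : Fin 4) => ?_) (Primrec.const _)))
    · fin_cases i
      · exact lin 1 hj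
      · exact lin 1 (Primrec.succ.comp hj)
    · fin_cases i
      · exact lin 1 hj
      · exact lin 1 (Primrec.succ.comp hj)
    · fin_cases i
      · exact Primrec.const _
      · exact lin 1 hj
      · exact Primrec.const _
      · exact lin 15 (Primrec.succ.comp ((Primrec.dom_finite Fin.val).comp
          (Primrec.list_getD blank)))
  refine ((Primrec.list_append.comp (Primrec.list_append.comp (Primrec.const
    ((constFacts m κ).map (RelFact.map Elem.code))) hblank)
    (Primrec.list_flatMap (Primrec.list_range.comp hlen) hword))).of_eq fun w => ?_
  simp only [codedFacts, initFacts, List.map_append, List.map_flatMap]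

/-- Entailment over transitive closure is equivalent to the automaton reaching a target state. -/
theorem entailsTC_iff {f : Fin κ → Fin κ → Fin κ → Fin κ} {H : Set (Fin κ)} {blank : Fin κ}
    {labs : Fin m → Fin 4 → Fin (κ + 1)} (hlabs : ∀ L, (∃ i, labs i = L) ↔ IsBad f H L)
    (w : List (Fin κ)) :
    EntailsTC {a | a ∈ codedFacts m blank w} (deps m) (query labs) ↔
      ∃ i z, caRun f (wordRow blank w) i z ∈ H := by
  constructor
  · intro h
    by_contra hno
    push Not at hno
    -- Decoding is an injective interpretation of all names in the countermodel.
    let e := Equiv.ofBijective _ Elem.code_bijective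
    have : Nonempty Elem := ⟨dummy⟩
    refine not_query_holds_model (n := w.length) (blank := blank) (fun i => (hlabs _).1 ⟨i, rfl⟩)
      (fun _ _ => rfl) hno (h Elem e.symm e.symm.injective _ ?_ ?_ respectsTC_model)
    · rintro _ ⟨_, hb, rfl⟩
      obtain ⟨a, ha, rfl⟩ := List.mem_map.1 (show _ ∈ List.map _ _ from hb)
      have : (a.map Elem.code).map e.symm = a := by
        obtain ⟨r, v⟩ := a
        exact congrArg (RelFact.mk r) (funext fun i => e.symm_apply_apply (v i))
      rw [this]
      exact initFacts_subset_model rfl ha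
    · exact closed_iff.2 (closed_model
        (fun j hj => List.getD_eq_default _ _ (by omega))
        (fun j => by
          rw [show -(j : ℤ) - 1 = Int.negSucc j by rw [Int.negSucc_eq]; ring]
          rfl))
  · intro h A ι _ F hF hΘ htc
    have : Nonempty A := ⟨ι 0⟩
    refine query_holds_of_halts (ι := ι ∘ Elem.code) (blank := blank) (w := w) (fun a ha => ?_)
      (closed_iff.1 hΘ) htc hlabs h
    exact hF ⟨_, List.mem_map_of_mem ha, rfl⟩

end Grid

/-- There are a fixed signature with a single distinguished relation, a fixed finite set of
inclusion dependencies and a fixed Boolean conjunctive query over the base relations for which no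
algorithm decides, given a finite set of facts (as a list), whether it entails the query over
transitive closure. -/
theorem mainTheorem10 :
    ∃ (σ : TCSignature) (Θ : Set (InclDep σ)) (Q : BoolCQ σ),
      σ.numDist = 1 ∧ Θ.Finite ∧ Q.IsBase ∧
        ¬ ComputablePred (fun L : List (RelFact σ ℕ) => EntailsTC {f | f ∈ L} Θ Q) := by
  obtain ⟨κ, f, H, blank, w, hw, hundec⟩ := exists_automaton_undecidable
  obtain ⟨m, labs, hlabs⟩ := Grid.exists_bad_enumeration f H
  refine ⟨gridSig m, Grid.deps m, Grid.query labs, rfl, Grid.deps_finite m,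
    Grid.query_isBase labs, fun h => hundec ?_⟩
  exact ComputablePred.computable_of_manyOneReducible
    ⟨fun n => Grid.codedFacts m blank (w n), ((Grid.primrec_codedFacts m blank).comp hw).to_comp,
      fun n => (Grid.entailsTC_iff hlabs (w n)).symm⟩ h
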